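/- For an open set $\Omega\subset\mathbb C^n$ let $K_\Omega$ be its Bergman kernel, i.e. the reproducing kernel of the space of square-integrable holomorphic functions on $\Omega$, and, where $K_\Omega(z,z)>0$, let $$F_B^\Omega(p,\xi)=\Bigl(\sum_{\nu,\mu=1}^n\frac{\partial^2\log K_\Omega(z,z)}{\partial z_\nu\,\partial\overline{z_\mu}}\Big|_{z=p}\,\xi_\nu\overline{\xi_\mu}\Bigr)^{1/2},\qquad p\in\Omega,\ \xi\in\mathbb C^n,$$ be its Bergman metric. Let $\mathbb B^2=\{z\in\mathbb C^2:|z|<1\}$ and, for $0<r<1$, let $\Omega_r=\{z\in\mathbb C^2: r<|z|<1\}$, where $|\cdot|$ is the Euclidean norm. There is a $\delta>0$ such that for all $r,\varepsilon$ with $0<r<\delta$ and $0<\varepsilon<\delta$, and for every $\xi\in\mathbb C^2$ with $\xi\neq 0$, the point $p=(r+\varepsilon,0)$ satisfies $$F_B^{\Omega_r}(p,\xi)<F_B^{\mathbb B^2}(p,\xi).$$ -/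

import Mathlib

open MeasureTheory

noncomputable section

/-- `f` belongs to the Bergman space of `Ω`: it is holomorphic on `Ω` and square integrable
over `Ω` with respect to Lebesgue measure. -/
def MemBergmanSpace {n : ℕ} (Ω : Set (EuclideanSpace ℂ (Fin n)))
    (f : EuclideanSpace ℂ (Fin n) → ℂ) : Prop :=
  DifferentiableOn ℂ f Ω ∧ MemLp f 2 (volume.restrict Ω)

/-- `K` is a Bergman kernel of `Ω`: for every `w ∈ Ω` the function `K (·, w)` lies in the Bergman
space, and `f w = ∫_Ω f z * conj (K (z, w))` for every `f` in the Bergman space. -/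
def IsBergmanKernel {n : ℕ} (Ω : Set (EuclideanSpace ℂ (Fin n)))
    (K : EuclideanSpace ℂ (Fin n) → EuclideanSpace ℂ (Fin n) → ℂ) : Prop :=
  ∀ w ∈ Ω, MemBergmanSpace Ω (fun z => K z w) ∧
    ∀ f : EuclideanSpace ℂ (Fin n) → ℂ, MemBergmanSpace Ω f →
      f w = ∫ z in Ω, f z * (starRingEnd ℂ) (K z w)

/-- A Bergman kernel is Hermitian, and any two of them are conjugate under exchanging the two
variables. -/
theorem IsBergmanKernel.conj_swap {n : ℕ} {Ω : Set (EuclideanSpace ℂ (Fin n))}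
    {K L : EuclideanSpace ℂ (Fin n) → EuclideanSpace ℂ (Fin n) → ℂ}
    (hK : IsBergmanKernel Ω K) (hL : IsBergmanKernel Ω L)
    {z w : EuclideanSpace ℂ (Fin n)} (hz : z ∈ Ω) (hw : w ∈ Ω) :
    L w z = (starRingEnd ℂ) (K z w) := by
  rw [(hL z hz).2 _ (hK w hw).1, (hK w hw).2 _ (hL z hz).1, ← integral_conj]
  refine integral_congr_ae (Filter.Eventually.of_forall fun x => ?_)
  simp [mul_comm]

/-- The Bergman kernel is unique on `Ω × Ω`. -/
theorem IsBergmanKernel.unique {n : ℕ} {Ω : Set (EuclideanSpace ℂ (Fin n))}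
    {K L : EuclideanSpace ℂ (Fin n) → EuclideanSpace ℂ (Fin n) → ℂ}
    (hK : IsBergmanKernel Ω K) (hL : IsBergmanKernel Ω L)
    {z w : EuclideanSpace ℂ (Fin n)} (hz : z ∈ Ω) (hw : w ∈ Ω) : K z w = L z w := by
  rw [hK.conj_swap hL hw hz, hK.conj_swap hK hw hz]

open Classical in
/-- The Bergman kernel `K_Ω (z, w)`. Every open set has one, and its values on `Ω × Ω` are
unique; the values elsewhere play no role. -/
def bergmanKernel {n : ℕ} (Ω : Set (EuclideanSpace ℂ (Fin n))) :
    EuclideanSpace ℂ (Fin n) → EuclideanSpace ℂ (Fin n) → ℂ :=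
  if h : ∃ K, IsBergmanKernel Ω K then h.choose else 0

/-- `bergmanKernel Ω` agrees on `Ω × Ω` with any Bergman kernel of `Ω`. -/
theorem IsBergmanKernel.eq_bergmanKernel {n : ℕ} {Ω : Set (EuclideanSpace ℂ (Fin n))}
    {K : EuclideanSpace ℂ (Fin n) → EuclideanSpace ℂ (Fin n) → ℂ} (hK : IsBergmanKernel Ω K)
    {z w : EuclideanSpace ℂ (Fin n)} (hz : z ∈ Ω) (hw : w ∈ Ω) :
    bergmanKernel Ω z w = K z w := by
  have h : ∃ K, IsBergmanKernel Ω K := ⟨K, hK⟩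
  rw [bergmanKernel, dif_pos h]
  exact h.choose_spec.unique hK hz hw

/-- The Wirtinger derivative `∂f/∂z_ν = (∂f/∂x_ν - i ∂f/∂y_ν) / 2`, where `z_ν = x_ν + i y_ν`. -/
def wirtinger {n : ℕ} (ν : Fin n) (f : EuclideanSpace ℂ (Fin n) → ℂ)
    (z : EuclideanSpace ℂ (Fin n)) : ℂ :=
  (fderiv ℝ f z (EuclideanSpace.single ν 1)
    - Complex.I * fderiv ℝ f z (EuclideanSpace.single ν Complex.I)) / 2

/-- The Wirtinger derivative `∂f/∂z̄_μ = (∂f/∂x_μ + i ∂f/∂y_μ) / 2`, where `z_μ = x_μ + i y_μ`. -/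
def wirtingerBar {n : ℕ} (μ : Fin n) (f : EuclideanSpace ℂ (Fin n) → ℂ)
    (z : EuclideanSpace ℂ (Fin n)) : ℂ :=
  (fderiv ℝ f z (EuclideanSpace.single μ 1)
    + Complex.I * fderiv ℝ f z (EuclideanSpace.single μ Complex.I)) / 2

/-- The function `z ↦ log K_Ω (z, z)`; note that `K_Ω (z, z)` is real and nonnegative. -/
def logBergmanKernel {n : ℕ} (Ω : Set (EuclideanSpace ℂ (Fin n)))
    (z : EuclideanSpace ℂ (Fin n)) : ℂ :=
  (Real.log (bergmanKernel Ω z z).re : ℂ)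

/-- The Bergman metric
`F_B^Ω (p, ξ) = (∑ ν μ, ∂²/∂z_ν∂z̄_μ log K_Ω (z, z) |_{z = p} * ξ_ν * conj ξ_μ) ^ (1/2)`.
The sum is real and nonnegative. -/
def bergmanMetric {n : ℕ} (Ω : Set (EuclideanSpace ℂ (Fin n)))
    (p ξ : EuclideanSpace ℂ (Fin n)) : ℝ :=
  Real.sqrt (∑ ν : Fin n, ∑ μ : Fin n,
    wirtinger ν (wirtingerBar μ (logBergmanKernel Ω)) p * ξ ν * (starRingEnd ℂ) (ξ μ)).re

/-- The ring domain `{r < |z| < 1}` in `ℂⁿ`. -/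
def ringDomain (n : ℕ) (r : ℝ) : Set (EuclideanSpace ℂ (Fin n)) :=
  {z | r < ‖z‖ ∧ ‖z‖ < 1}

end

noncomputable section

open Complex Real Metric Set Filter Topology

/-! Ring and ball are both shells `R < |z|² < 1`, the ball with `R < 0`. With `q = max R 0` and `x =
⟪w, z⟫`, the Bergman kernel of a shell is `(2/π²) ∑_j q^(2j) / (1 - q^j x)^3`; for `q = 0` only the
ball kernel `j = 0` survives. Heuristically, removing the inner ball multiplies the squared norm of
a homogeneous polynomial of degree `k` by `1 - q^(k+2)`, whose inverse is a geometric series.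

The formula is verified without orthogonal expansions (`isBergmanKernel_euclideanShell`). A unitary
change of coordinates moves `w` to `(s, 0)`, so that the kernel depends on `z₁` alone. For `f`
holomorphic on the shell, the mean `G(a)` of `f(a, ·)` over circles about `0` does not depend on the
circle, is holomorphic on the whole unit disc, and equals `f(a, 0)` where `(a, 0)` lies in the
shell: Hartogs extension in miniature. Integrating `f` against the conjugate of `1/(1 - α z₁)^3`
gives `(π²/2)(G(α) - q² G(qα))` (`integral_shell_mul_conj`). Taking `α = q^j s` with weight
`q^(2j)`, the sum over `j` telescopes to `G(s) = f(s, 0)`.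

On the diagonal, with `t = |z|²`, the logarithm of the kernel is that of the ball plus `log(1 +
E(t))`, where `E(t) = ∑_{j≥1} q^(2j) ((1-t)/(1-q^j t))^3`. For a potential `L(|z|²)` the squared
metric at `(s, 0)` is `(L' + tL'')|ξ₀|² + L'|ξ₁|²`. The correction `log(1 + E)` lowers both
coefficients once `E' < 0` and `E' + tE'' < 0`, since its remaining contribution `-t(E'/(1+E))²` is
nonpositive. Both inequalities hold term by term for `0 < t < 1/3` (`ratioCubeDeriv_neg`,
`ratioCubeDeriv_add_neg`). -/

/-! ### Circle means and one-variable Cauchy identities. -/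

theorem integral_eq_integral_circleAverage {F : ℂ → ℂ} (hm : Measurable F) (hF : Integrable F) :
    ∫ z, F z = ∫ ρ in Ioi (0 : ℝ), (2 * π * ρ : ℝ) • circleAverage F 0 ρ := by
  have hsymm : ∀ p : ℝ × ℝ, Complex.polarCoord.symm p = circleMap 0 p.1 p.2 := fun p => by
    rw [Complex.polarCoord_symm_apply, circleMap, Complex.exp_mul_I]; simp
  have hint : Integrable (fun p : ℝ × ℝ => p.1 • F (circleMap 0 p.1 p.2))
      (volume.restrict (Ioi (0 : ℝ) ×ˢ Ioo (-π) π)) := by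
    have hc : Continuous fun p : ℝ × ℝ => circleMap 0 p.1 p.2 := by fun_prop [circleMap]
    refine ⟨(measurable_fst.smul (hm.comp hc.measurable)).aestronglyMeasurable, ?_⟩
    have h1 := Complex.lintegral_comp_polarCoord_symm (fun z => ‖F z‖ₑ)
    have h2 : ∫⁻ z, ‖F z‖ₑ < ⊤ := hF.2
    rw [← h1, polarCoord_target] at h2
    refine lt_of_eq_of_lt ?_ h2
    refine setLIntegral_congr_fun (measurableSet_Ioi.prod measurableSet_Ioo) fun p hp => ?_
    simp only [enorm_smul, hsymm, smul_eq_mul]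
    rw [Real.enorm_of_nonneg (le_of_lt hp.1)]
  rw [← Complex.integral_comp_polarCoord_symm, polarCoord_target]
  simp_rw [hsymm]
  rw [Measure.volume_eq_prod, setIntegral_prod _ (by rwa [IntegrableOn, ← Measure.volume_eq_prod])]
  refine setIntegral_congr_fun measurableSet_Ioi fun ρ _ => ?_
  -- Polar coordinates use angles in `(-π, π)`, circle averages use `[0, 2π]`; periodicity
  -- reconciles them.
  have hper : Function.Periodic (fun θ => F (circleMap 0 ρ θ)) (2 * π) := fun x => by
    simp [periodic_circleMap 0 ρ x]
  have h3 := hper.intervalIntegral_add_eq (-π) 0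
  rw [show -π + 2 * π = π by ring, zero_add] at h3
  simp only
  rw [integral_smul, ← integral_Ioc_eq_integral_Ioo,
    ← intervalIntegral.integral_of_le (by linarith [pi_pos]), h3, circleAverage, smul_smul]
  congr 1
  field_simp

/-- Integration by parts: the derivative of `h / (z - y)^(n+1)` integrates to zero over the circle.
Two uses bring a triple pole down to the simple pole of Cauchy's formula. -/
theorem circleIntegral_div_sub_pow_succ {h h' : ℂ → ℂ} {ρ : ℝ} {y : ℂ} (n : ℕ) (hρ : 0 < ρ)
    (hy : y ∈ ball (0 : ℂ) ρ) (hd : ∀ z ∈ sphere (0 : ℂ) ρ, HasDerivAt h (h' z) z)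
    (hc : ContinuousOn h' (sphere 0 ρ)) :
    ∮ z in C(0, ρ), h' z / (z - y) ^ (n + 1)
      = (n + 1) * ∮ z in C(0, ρ), h z / (z - y) ^ (n + 2) := by
  have hne : ∀ z ∈ sphere (0 : ℂ) ρ, z - y ≠ 0 := fun z hz h0 => by
    rw [sub_eq_zero.1 h0] at hz
    simp at hz hy; linarith
  have hch : ContinuousOn h (sphere 0 ρ) := fun z hz => (hd z hz).continuousAt.continuousWithinAt
  have hi1 : CircleIntegrable (fun z => h' z / (z - y) ^ (n + 1)) 0 ρ :=
    ContinuousOn.circleIntegrable hρ.le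
      (hc.div (by fun_prop) fun z hz => pow_ne_zero _ (hne z hz))
  have hi2 : CircleIntegrable (fun z => (n + 1 : ℂ) * (h z / (z - y) ^ (n + 2))) 0 ρ :=
    ContinuousOn.circleIntegrable hρ.le
      (continuousOn_const.mul (hch.div (by fun_prop) fun z hz => pow_ne_zero _ (hne z hz)))
  have h0 := circleIntegral.integral_eq_zero_of_hasDerivWithinAt hρ.le
    (f := fun z => h z / (z - y) ^ (n + 1))
    (f' := fun z => h' z / (z - y) ^ (n + 1) - (n + 1 : ℂ) * (h z / (z - y) ^ (n + 2)))
    (c := 0) fun z hz => by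
      have := ((hd z hz).div (((hasDerivAt_id z).sub_const y).pow (n + 1))
        (pow_ne_zero _ (hne z hz))).hasDerivWithinAt (s := sphere 0 ρ)
      refine this.congr_deriv ?_
      have := hne z hz
      simp only [id, Pi.pow_apply, Nat.add_sub_cancel]
      push_cast
      field_simp
      ring
  rw [circleIntegral.integral_sub hi1 hi2, circleIntegral.integral_const_mul, sub_eq_zero] at h0
  exact h0

/-- The second derivative of `z ↦ z ^ 2 * g z`, halved. -/
def halfSecondDeriv (g : ℂ → ℂ) (y : ℂ) : ℂ :=
  g y + 2 * y * deriv g y + y ^ 2 * deriv (deriv g) y / 2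

theorem hasDerivAt_sq_mul {g : ℂ → ℂ} (hg : DifferentiableOn ℂ g (ball 0 1)) {z : ℂ}
    (hz : z ∈ ball (0 : ℂ) 1) :
    HasDerivAt (fun z => z ^ 2 * g z) (2 * z * g z + z ^ 2 * deriv g z) z := by
  have h := (hg.differentiableAt (isOpen_ball.mem_nhds hz)).hasDerivAt
  refine (((hasDerivAt_id z).pow 2).mul h).congr_deriv ?_
  simp

theorem hasDerivAt_deriv_sq_mul {g : ℂ → ℂ} (hg : DifferentiableOn ℂ g (ball 0 1)) {z : ℂ}
    (hz : z ∈ ball (0 : ℂ) 1) :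
    HasDerivAt (fun z => 2 * z * g z + z ^ 2 * deriv g z) (2 * halfSecondDeriv g z) z := by
  have h := (hg.differentiableAt (isOpen_ball.mem_nhds hz)).hasDerivAt
  have h' := ((hg.deriv isOpen_ball).differentiableAt (isOpen_ball.mem_nhds hz)).hasDerivAt
  refine ((((hasDerivAt_id z).const_mul 2).mul h).add
    (((hasDerivAt_id z).pow 2).mul h')).congr_deriv ?_
  simp [halfSecondDeriv]
  ring

theorem differentiableOn_halfSecondDeriv {g : ℂ → ℂ} (hg : DifferentiableOn ℂ g (ball 0 1)) :
    DifferentiableOn ℂ (halfSecondDeriv g) (ball 0 1) := by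
  have h1 := hg.deriv isOpen_ball
  have h2 := h1.deriv isOpen_ball
  unfold halfSecondDeriv
  fun_prop

/-- On `|z| = ρ` one has `z (1 - a z̄) = z - aρ²`, so the average is a Cauchy integral of `z² g(z)`
with a triple pole at `aρ²`, i.e. half a second derivative there. -/
theorem circleAverage_mul_conj_kernel {g : ℂ → ℂ} (hg : DifferentiableOn ℂ g (ball 0 1))
    {ρ a : ℝ} (hρ : 0 < ρ) (hρ1 : ρ < 1) (ha : 0 ≤ a) (ha1 : a < 1) :
    circleAverage (fun z => g z * (starRingEnd ℂ) (1 / (1 - a * z) ^ 3)) 0 ρ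
      = halfSecondDeriv g (a * ρ ^ 2 : ℝ) := by
  set y : ℂ := ((a * ρ ^ 2 : ℝ) : ℂ) with hy
  have hyb : y ∈ ball (0 : ℂ) ρ := by
    rw [mem_ball_zero_iff, hy, Complex.norm_real, Real.norm_of_nonneg (by positivity)]
    nlinarith [mul_pos hρ hρ]
  have hsub : closedBall (0 : ℂ) ρ ⊆ ball 0 1 := closedBall_subset_ball hρ1
  have hss : sphere (0 : ℂ) ρ ⊆ ball 0 1 := sphere_subset_closedBall.trans hsub
  have e1 : circleAverage (fun z => g z * (starRingEnd ℂ) (1 / (1 - a * z) ^ 3)) 0 ρ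
      = (2 * π * I)⁻¹ • ∮ z in C(0, ρ), z ^ 2 * g z / (z - y) ^ 3 := by
    rw [circleAverage_eq_circleIntegral hρ.ne']
    congr 1
    refine circleIntegral.integral_congr hρ.le fun z hz => ?_
    have hzn : ‖z‖ = ρ := by simpa using hz
    have hz0 : z ≠ 0 := fun h => by simp [h] at hzn; linarith
    have hcz : z * (starRingEnd ℂ) z = (ρ : ℂ) ^ 2 := by rw [Complex.mul_conj']; simp [hzn]
    have hzy : z - y = z * (1 - a * (starRingEnd ℂ) z) := by
      rw [mul_sub, mul_left_comm, hcz, hy]; push_cast; ring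
    have hne : 1 - a * (starRingEnd ℂ) z ≠ 0 := fun h => by
      rw [h, mul_zero, sub_eq_zero] at hzy
      rw [hzy] at hzn
      rw [mem_ball_zero_iff] at hyb; linarith
    simp only [sub_zero, smul_eq_mul, map_div₀, map_one, map_pow, map_sub, map_mul,
      Complex.conj_ofReal]
    rw [hzy]
    field_simp
  have hN := differentiableOn_halfSecondDeriv hg
  have hc2 : ContinuousOn (fun z => 2 * halfSecondDeriv g z) (sphere 0 ρ) :=
    (continuousOn_const.mul (hN.continuousOn.mono hss))
  have hc1 : ContinuousOn (fun z => 2 * z * g z + z ^ 2 * deriv g z) (sphere 0 ρ) := fun z hz =>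
    (hasDerivAt_deriv_sq_mul hg (hss hz)).continuousAt.continuousWithinAt
  have s1 := circleIntegral_div_sub_pow_succ 1 hρ hyb
    (fun z hz => hasDerivAt_sq_mul hg (hss hz)) hc1
  have s2 := circleIntegral_div_sub_pow_succ 0 hρ hyb
    (fun z hz => hasDerivAt_deriv_sq_mul hg (hss hz)) hc2
  have s3 := ((hN.const_mul 2).mono hsub).circleIntegral_sub_inv_smul hyb
  have s4 : ∮ z in C(0, ρ), 2 * halfSecondDeriv g z / (z - y) ^ (0 + 1)
      = ∮ z in C(0, ρ), (z - y)⁻¹ • (2 * halfSecondDeriv g z) := by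
    refine circleIntegral.integral_congr hρ.le fun z _ => ?_
    simp [div_eq_inv_mul]
  rw [e1]
  norm_num at s1 s2 s3 s4
  rw [s4] at s2
  rw [← s2] at s1
  have : (∮ z in C(0, ρ), z ^ 2 * g z / (z - y) ^ 3) = (2 * π * I) * halfSecondDeriv g y := by
    have h2 : (2:ℂ) ≠ 0 := by norm_num
    apply mul_left_cancel₀ h2
    rw [← s1, s3]; ring
  rw [this, smul_eq_mul, inv_mul_cancel_left₀ Complex.two_pi_I_ne_zero]

/-- Taylor's formula with integral remainder for `u(x) = x² g(ax)`: here `u'' = 2 * halfSecondDeriv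
g (a x)` and `u(0) = u'(0) = 0`. The primitive used is `(q - x) u' + u`. -/
theorem integral_sub_mul_halfSecondDeriv {g : ℂ → ℂ} (hg : DifferentiableOn ℂ g (ball 0 1))
    {a q : ℝ} (ha : 0 ≤ a) (ha1 : a < 1) (hq : 0 ≤ q) (hq1 : q ≤ 1) :
    ∫ x in (0 : ℝ)..q, ((q - x : ℝ) : ℂ) * halfSecondDeriv g (a * x : ℝ)
      = q ^ 2 * g (q * a : ℝ) / 2 := by
  have hmem : ∀ x ∈ uIcc 0 q, ((a * x : ℝ) : ℂ) ∈ ball (0 : ℂ) 1 := fun x hx => by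
    rw [uIcc_of_le hq] at hx
    rw [mem_ball_zero_iff, Complex.norm_real, Real.norm_of_nonneg (mul_nonneg ha hx.1)]
    nlinarith [hx.1, hx.2]
  have hx' : ∀ x : ℝ, HasDerivAt (fun x : ℝ => ((a * x : ℝ) : ℂ)) (a : ℂ) x := fun x => by
    have := ((hasDerivAt_id x).const_mul a).ofReal_comp
    simpa using this
  have hxr : ∀ x : ℝ, HasDerivAt (fun x : ℝ => (x : ℂ)) 1 x := fun x => by
    simpa using (hasDerivAt_id x).ofReal_comp
  have key : ∀ x ∈ uIcc 0 q, HasDerivAt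
      (fun x : ℝ => ((q : ℂ) - x) * (2 * x * g (a * x : ℝ) + a * x ^ 2 * deriv g (a * x : ℝ))
        + x ^ 2 * g (a * x : ℝ))
      (2 * (((q - x : ℝ) : ℂ) * halfSecondDeriv g (a * x : ℝ))) x := fun x hx => by
    have h := (hg.differentiableAt (isOpen_ball.mem_nhds (hmem x hx))).hasDerivAt
    have h' := ((hg.deriv isOpen_ball).differentiableAt
      (isOpen_ball.mem_nhds (hmem x hx))).hasDerivAt
    have d0 := HasDerivAt.comp x h (hx' x)
    have d1 := HasDerivAt.comp x h' (hx' x)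
    have := ((((hxr x).const_sub (q : ℂ)).mul ((((hxr x).const_mul 2).mul d0).add
      ((((hxr x).pow 2).const_mul (a : ℂ)).mul d1)))).add (((hxr x).pow 2).mul d0)
    refine this.congr_deriv ?_
    simp [halfSecondDeriv]
    ring
  have hcont : ContinuousOn (fun x : ℝ => 2 * (((q - x : ℝ) : ℂ) * halfSecondDeriv g (a * x : ℝ)))
      (uIcc 0 q) := by
    have : ContinuousOn (fun x : ℝ => halfSecondDeriv g (a * x : ℝ)) (uIcc 0 q) :=
      (differentiableOn_halfSecondDeriv hg).continuousOn.comp (by fun_prop) hmem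
    fun_prop
  have := intervalIntegral.integral_eq_sub_of_hasDerivAt key hcont.intervalIntegrable
  rw [intervalIntegral.integral_const_mul] at this
  rw [eq_div_iff two_ne_zero, mul_comm, this]
  push_cast
  rw [mul_comm (a : ℂ) q]
  ring

/-! ### Slice means of holomorphic functions on a shell. -/

/-- Differentiation under the integral. The dominating constant comes from Cauchy's estimate on
discs of radius `η / 4` centred in `ball a (η / 4)`; these stay in `closedBall a (η / 2)`, over
which `f` is bounded by compactness. -/
theorem differentiableAt_circleAverage_snd {f : ℂ × ℂ → ℂ} {U : Set (ℂ × ℂ)} (hU : IsOpen U)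
    (hf : DifferentiableOn ℂ f U) {a : ℂ} {σ : ℝ} (hσ : 0 ≤ σ)
    (h : ∀ w ∈ sphere (0 : ℂ) σ, (a, w) ∈ U) :
    DifferentiableAt ℂ (fun z => circleAverage (fun w => f (z, w)) 0 σ) a := by
  obtain ⟨u, v, hu, -, hau, hsv, huv⟩ := generalized_tube_lemma (isCompact_singleton (x := a))
    (isCompact_sphere (0 : ℂ) σ) hU (by rintro ⟨x, w⟩ ⟨rfl, hw⟩; exact h w hw)
  obtain ⟨η, hη, hηu⟩ := Metric.isOpen_iff.1 hu a (hau rfl)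
  have hmem : ∀ z ∈ ball a η, ∀ θ : ℝ, (z, circleMap 0 σ θ) ∈ U := fun z hz θ =>
    huv ⟨hηu hz, hsv (circleMap_mem_sphere 0 hσ θ)⟩
  have hK : IsCompact (closedBall a (η / 2) ×ˢ sphere (0 : ℂ) σ) :=
    (isCompact_closedBall _ _).prod (isCompact_sphere _ _)
  have hKU : closedBall a (η / 2) ×ˢ sphere (0 : ℂ) σ ⊆ U := fun p hp =>
    huv ⟨hηu (closedBall_subset_ball (by linarith) hp.1), hsv hp.2⟩
  obtain ⟨M, hM⟩ := hK.exists_bound_of_continuousOn (hf.continuousOn.mono hKU)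
  have hdiff : ∀ z ∈ ball a η, ∀ θ : ℝ,
      DifferentiableAt ℂ (fun z => f (z, circleMap 0 σ θ)) z := fun z hz θ =>
    (hf.differentiableAt (hU.mem_nhds (hmem z hz θ))).comp z (by fun_prop)
  have hcont : ∀ z ∈ ball a η, Continuous fun θ : ℝ => f (z, circleMap 0 σ θ) := fun z hz =>
    hf.continuousOn.comp_continuous (by fun_prop) (hmem z hz)
  -- Measurability in `θ`: the derivative is a pointwise limit of difference quotients continuous in
  -- `θ`.
  have hmeas : AEStronglyMeasurable (fun θ : ℝ => deriv (fun z => f (z, circleMap 0 σ θ)) a)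
      (volume.restrict (uIoc 0 (2 * π))) := by
    have ht : Tendsto (fun n : ℕ => ((η / 2 * (1 / ((n : ℝ) + 1)) : ℝ) : ℂ)) atTop (𝓝[≠] 0) := by
      refine tendsto_nhdsWithin_iff.2 ⟨?_, Eventually.of_forall fun n => ?_⟩
      · have := (tendsto_one_div_add_atTop_nhds_zero_nat (𝕜 := ℝ)).const_mul (η / 2)
        rw [mul_zero] at this
        exact_mod_cast (Complex.continuous_ofReal.tendsto 0).comp this
      · have : 0 < η / 2 * (1 / ((n : ℝ) + 1)) := by positivity
        simpa only [mem_compl_iff, mem_singleton_iff, Complex.ofReal_eq_zero] using this.ne'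
    refine aestronglyMeasurable_of_tendsto_ae atTop
      (f := fun (n : ℕ) (θ : ℝ) => ((η / 2 * (1 / ((n : ℝ) + 1)) : ℝ) : ℂ)⁻¹ •
        (f (a + ((η / 2 * (1 / ((n : ℝ) + 1)) : ℝ) : ℂ), circleMap 0 σ θ)
          - f (a, circleMap 0 σ θ))) (fun n => ?_) (Eventually.of_forall fun θ => ?_)
    · have hn : a + ((η / 2 * (1 / ((n : ℝ) + 1)) : ℝ) : ℂ) ∈ ball a η := by
        rw [mem_ball_iff_norm, add_sub_cancel_left, Complex.norm_real,
          Real.norm_of_nonneg (by positivity)]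
        have : 1 / ((n : ℝ) + 1) ≤ 1 := by
          rw [div_le_one (by positivity)]; linarith [n.cast_nonneg (α := ℝ)]
        nlinarith
      exact ((continuous_const (y := ((η / 2 * (1 / ((n : ℝ) + 1)) : ℝ) : ℂ)⁻¹)).smul
        ((hcont _ hn).sub (hcont a (mem_ball_self hη)))).aestronglyMeasurable
    · exact (hasDerivAt_iff_tendsto_slope_zero.1
        (hdiff a (mem_ball_self hη) θ).hasDerivAt).comp ht
  have key := intervalIntegral.hasDerivAt_integral_of_dominated_loc_of_deriv_le (𝕜 := ℂ)
    (μ := volume) (a := 0) (b := 2 * π) (s := ball a (η / 4))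
    (F := fun z θ => f (z, circleMap 0 σ θ))
    (F' := fun z θ => deriv (fun z => f (z, circleMap 0 σ θ)) z) (bound := fun _ => M / (η / 4))
    (x₀ := a) (ball_mem_nhds a (by positivity))
    (Filter.mem_of_superset (ball_mem_nhds a hη)
      fun z hz => (hcont z hz).aestronglyMeasurable)
    ((hcont a (mem_ball_self hη)).intervalIntegrable _ _) hmeas
    (Eventually.of_forall fun θ _ z hz => ?_) (by simp)
    (Eventually.of_forall fun θ _ z hz => ?_)
  · unfold circleAverage
    exact key.2.differentiableAt.const_smul ((2 * π)⁻¹ : ℝ)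
  · have hsub : closedBall z (η / 4) ⊆ closedBall a (η / 2) := by
      refine closedBall_subset_closedBall' ?_
      have := mem_ball.1 hz; linarith
    refine norm_deriv_le_of_forall_mem_sphere_norm_le (by positivity) ?_ fun x hx => ?_
    · refine DifferentiableOn.diffContOnCl_ball (U := ball a η) (fun x hx =>
        (hdiff x hx θ).differentiableWithinAt) (hsub.trans (closedBall_subset_ball (by linarith)))
    · exact hM _ ⟨hsub (sphere_subset_closedBall hx), circleMap_mem_sphere 0 hσ θ⟩
  · exact (hdiff z (ball_subset_ball (by linarith) hz) θ).hasDerivAt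

/-- The shell `{R < |z|² < 1}` in `ℂ × ℂ`; it is a ball when `R < 0`. -/
def shell (R : ℝ) : Set (ℂ × ℂ) :=
  {z | R < ‖z.1‖ ^ 2 + ‖z.2‖ ^ 2 ∧ ‖z.1‖ ^ 2 + ‖z.2‖ ^ 2 < 1}

theorem isOpen_shell (R : ℝ) : IsOpen (shell R) := by
  have hc : Continuous fun z : ℂ × ℂ => ‖z.1‖ ^ 2 + ‖z.2‖ ^ 2 := by fun_prop
  exact (isOpen_lt continuous_const hc).inter (isOpen_lt hc continuous_const)

theorem differentiableAt_slice {f : ℂ × ℂ → ℂ} {R : ℝ} (hf : DifferentiableOn ℂ f (shell R))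
    {a w : ℂ} (h : (a, w) ∈ shell R) : DifferentiableAt ℂ (fun w => f (a, w)) w :=
  (hf.differentiableAt ((isOpen_shell R).mem_nhds h)).comp w (by fun_prop)

/-- The closed annulus between the two circles lies in the slice, so Cauchy's theorem applies to
`f(a, w) / w` there. -/
theorem circleAverage_slice_congr {f : ℂ × ℂ → ℂ} {R : ℝ} (hf : DifferentiableOn ℂ f (shell R))
    {a : ℂ} {σ τ : ℝ} (hσ : 0 < σ) (hστ : σ ≤ τ) (h1 : R < ‖a‖ ^ 2 + σ ^ 2)
    (h2 : ‖a‖ ^ 2 + τ ^ 2 < 1) :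
    circleAverage (fun w => f (a, w)) 0 σ = circleAverage (fun w => f (a, w)) 0 τ := by
  have hmem : ∀ w ∈ closedBall (0 : ℂ) τ \ ball 0 σ, (a, w) ∈ shell R := fun w hw => by
    have hw1 : ‖w‖ ≤ τ := by simpa using hw.1
    have hw2 : σ ≤ ‖w‖ := by simpa using hw.2
    constructor
    · refine h1.trans_le (add_le_add le_rfl (pow_le_pow_left₀ hσ.le hw2 2))
    · refine lt_of_le_of_lt (add_le_add le_rfl (pow_le_pow_left₀ (norm_nonneg _) hw1 2)) h2
  rw [circleAverage_eq_circleIntegral hσ.ne', circleAverage_eq_circleIntegral (hσ.trans_le hστ).ne',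
    circleIntegral_sub_center_inv_smul_eq_of_differentiable_on_annulus_off_countable hσ hστ
      countable_empty]
  · exact fun w hw => (differentiableAt_slice hf (hmem w hw)).continuousAt.continuousWithinAt
  · exact fun w hw => differentiableAt_slice hf
      (hmem w ⟨ball_subset_closedBall hw.1.1, fun h => hw.1.2 (ball_subset_closedBall h)⟩)

/-- The radius of a circle that lies in the slice of `shell R` over `a`. -/
def sliceRadius (R : ℝ) (a : ℂ) : ℝ := √((max (R - ‖a‖ ^ 2) 0 + (1 - ‖a‖ ^ 2)) / 2)

/-- The mean of `f` over any circle centred on the axis in the slice of `shell R` over `a`. -/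
def sliceMean (f : ℂ × ℂ → ℂ) (R : ℝ) (a : ℂ) : ℂ :=
  circleAverage (fun w => f (a, w)) 0 (sliceRadius R a)

/-- The squared radius is the midpoint of the nonempty interval from `max (R - ‖a‖²) 0` to `1 -
‖a‖²`. -/
theorem sliceRadius_spec {R : ℝ} (hR : R < 1) {a : ℂ} (ha : ‖a‖ < 1) :
    0 < sliceRadius R a ∧ R < ‖a‖ ^ 2 + sliceRadius R a ^ 2 ∧
      ‖a‖ ^ 2 + sliceRadius R a ^ 2 < 1 := by
  have ha2 : ‖a‖ ^ 2 < 1 := by nlinarith [norm_nonneg a]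
  have h0 : 0 ≤ max (R - ‖a‖ ^ 2) 0 := le_max_right _ _
  have h1 : R - ‖a‖ ^ 2 ≤ max (R - ‖a‖ ^ 2) 0 := le_max_left _ _
  have h2 : max (R - ‖a‖ ^ 2) 0 < 1 - ‖a‖ ^ 2 := max_lt (by linarith) (by linarith)
  have hsq : sliceRadius R a ^ 2 = (max (R - ‖a‖ ^ 2) 0 + (1 - ‖a‖ ^ 2)) / 2 :=
    Real.sq_sqrt (by linarith)
  refine ⟨Real.sqrt_pos.2 (by linarith), ?_, ?_⟩ <;> rw [hsq] <;> linarith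

theorem circleAverage_eq_sliceMean {f : ℂ × ℂ → ℂ} {R : ℝ} (hf : DifferentiableOn ℂ f (shell R))
    {a : ℂ} {σ : ℝ} (hσ : 0 < σ) (h1 : R < ‖a‖ ^ 2 + σ ^ 2) (h2 : ‖a‖ ^ 2 + σ ^ 2 < 1) :
    circleAverage (fun w => f (a, w)) 0 σ = sliceMean f R a := by
  have ha : ‖a‖ < 1 := by nlinarith [norm_nonneg a, sq_nonneg σ]
  obtain ⟨h3, h4, h5⟩ := sliceRadius_spec (h1.trans h2) ha
  rcases le_total σ (sliceRadius R a) with h | h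
  · exact circleAverage_slice_congr hf hσ h h1 h5
  · exact (circleAverage_slice_congr hf h3 h h4 h2).symm

/-- Near a given `a` the circle can be kept fixed, since admissibility of a radius is an open
condition. The disc includes points with `‖a‖² ≤ R`, where `(a, 0)` is outside the shell: this is
the extension across the hole. -/
theorem differentiableOn_sliceMean {f : ℂ × ℂ → ℂ} {R : ℝ} (hR : R < 1)
    (hf : DifferentiableOn ℂ f (shell R)) : DifferentiableOn ℂ (sliceMean f R) (ball 0 1) := by
  intro a ha
  rw [mem_ball_zero_iff] at ha
  obtain ⟨h0, h1, h2⟩ := sliceRadius_spec hR ha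
  have hd := differentiableAt_circleAverage_snd (isOpen_shell R) hf h0.le (a := a) fun w hw => by
    have hw : ‖w‖ = sliceRadius R a := by simpa using hw
    exact ⟨by simpa [hw] using h1, by simpa [hw] using h2⟩
  refine (hd.congr_of_eventuallyEq ?_).differentiableWithinAt
  have e1 : ∀ᶠ z : ℂ in 𝓝 a, R < ‖z‖ ^ 2 + sliceRadius R a ^ 2 :=
    (isOpen_lt (by fun_prop) (by fun_prop)).mem_nhds h1
  have e2 : ∀ᶠ z : ℂ in 𝓝 a, ‖z‖ ^ 2 + sliceRadius R a ^ 2 < 1 :=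
    (isOpen_lt (by fun_prop) (by fun_prop)).mem_nhds h2
  filter_upwards [e1, e2] with z hz1 hz2
  exact (circleAverage_eq_sliceMean hf h0 hz1 hz2).symm

/-- Over such `a` the slice is a full disc, so this is the mean value property. -/
theorem sliceMean_eq {f : ℂ × ℂ → ℂ} {R : ℝ} (hf : DifferentiableOn ℂ f (shell R)) {a : ℂ}
    (h : (a, 0) ∈ shell R) : sliceMean f R a = f (a, 0) := by
  have h1 : R < ‖a‖ ^ 2 := by simpa using h.1
  have h2 : ‖a‖ ^ 2 < 1 := by simpa using h.2
  have ha : ‖a‖ < 1 := by nlinarith [norm_nonneg a]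
  obtain ⟨h3, h4, h5⟩ := sliceRadius_spec (h1.trans h2) ha
  refine DiffContOnCl.circleAverage (DifferentiableOn.diffContOnCl_ball
    (U := closedBall 0 (sliceRadius R a)) (fun w hw => ?_) (by rw [abs_of_pos h3]))
  have hw : ‖w‖ ≤ sliceRadius R a := by simpa using hw
  refine (differentiableAt_slice hf ⟨?_, ?_⟩).differentiableWithinAt
  · exact h1.trans_le (by simp)
  · exact lt_of_le_of_lt (add_le_add le_rfl (pow_le_pow_left₀ (norm_nonneg _) hw 2)) h5

/-! ### Integration over a shell against one term of the kernel. -/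

theorem measurable_indicator_shell {f : ℂ × ℂ → ℂ} {R : ℝ} (hf : ContinuousOn f (shell R)) :
    Measurable ((shell R).indicator f) := by
  classical
  rw [← Set.piecewise_eq_indicator]
  exact hf.measurable_piecewise continuousOn_const (isOpen_shell R).measurableSet

/-- All circles in the slice carry the same mean, so the integral is the area of the slice times
that mean. -/
theorem integral_slice {f : ℂ × ℂ → ℂ} {R : ℝ} (hR : R < 1) (hf : DifferentiableOn ℂ f (shell R))
    {a : ℂ} (ha : ‖a‖ < 1) (hi : Integrable fun w => (shell R).indicator f (a, w)) :
    ∫ w, (shell R).indicator f (a, w)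
      = (π * (1 - ‖a‖ ^ 2 - max (max R 0 - ‖a‖ ^ 2) 0) : ℝ) * sliceMean f R a := by
  have ha2 : ‖a‖ ^ 2 < 1 := by nlinarith [norm_nonneg a]
  have hm : Measurable fun w => (shell R).indicator f (a, w) :=
    (measurable_indicator_shell hf.continuousOn).comp (by fun_prop)
  rw [integral_eq_integral_circleAverage hm hi]
  -- The square root of a negative number is `0`, so this inner radius is also right when the slice
  -- is a full disc.
  have hle : √(R - ‖a‖ ^ 2) ≤ √(1 - ‖a‖ ^ 2) := Real.sqrt_le_sqrt (by linarith)
  have e1 : ∀ ρ ∈ Ioi (0 : ℝ),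
      (2 * π * ρ : ℝ) • circleAverage (fun w => (shell R).indicator f (a, w)) 0 ρ
      = (Ioo √(R - ‖a‖ ^ 2) √(1 - ‖a‖ ^ 2)).indicator
        (fun ρ => (2 * π * ρ : ℝ) • sliceMean f R a) ρ := fun ρ hρ => by
    have hρ0 : 0 < ρ := hρ
    by_cases h : ρ ∈ Ioo √(R - ‖a‖ ^ 2) √(1 - ‖a‖ ^ 2)
    · rw [indicator_of_mem h]
      have h1 := (Real.sqrt_lt' hρ0).1 h.1
      have h2 := (Real.lt_sqrt hρ0.le).1 h.2
      rw [← circleAverage_eq_sliceMean hf hρ0 (by linarith) (by linarith)]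
      congr 1
      refine circleAverage_congr_sphere fun w hw => indicator_of_mem ?_ _
      have hw : ‖w‖ = ρ := by simpa [abs_of_pos hρ0] using hw
      exact ⟨by simp only [hw]; linarith, by simp only [hw]; linarith⟩
    · rw [indicator_of_notMem h]
      have : circleAverage (fun w => (shell R).indicator f (a, w)) 0 ρ
          = circleAverage (fun _ => 0) 0 ρ := by
        refine circleAverage_congr_sphere fun w hw => indicator_of_notMem (fun hw' => h ?_) _
        have hw : ‖w‖ = ρ := by simpa [abs_of_pos hρ0] using hw
        have h1 := hw'.1
        have h2 := hw'.2
        simp only [hw] at h1 h2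
        exact ⟨(Real.sqrt_lt' hρ0).2 (by linarith), (Real.lt_sqrt hρ0.le).2 (by linarith)⟩
      rw [this, circleAverage_const, smul_zero]
  have hinter : Ioi 0 ∩ Ioo √(R - ‖a‖ ^ 2) √(1 - ‖a‖ ^ 2)
      = Ioo √(R - ‖a‖ ^ 2) √(1 - ‖a‖ ^ 2) :=
    inter_eq_right.2 fun x hx => (Real.sqrt_nonneg _).trans_lt hx.1
  rw [setIntegral_congr_fun measurableSet_Ioi e1, setIntegral_indicator measurableSet_Ioo,
    hinter, integral_smul_const,
    ← integral_Ioc_eq_integral_Ioo, ← intervalIntegral.integral_of_le hle,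
    intervalIntegral.integral_const_mul, integral_id, Complex.real_smul]
  congr 2
  rw [Real.sq_sqrt (by linarith)]
  have e2 : √(R - ‖a‖ ^ 2) ^ 2 = max (max R 0 - ‖a‖ ^ 2) 0 := by
    rcases le_total (R - ‖a‖ ^ 2) 0 with h | h
    · rw [Real.sqrt_eq_zero_of_nonpos h, max_eq_right]; · simp
      have := sq_nonneg ‖a‖
      rcases le_total R 0 with h' | h'
      · rw [max_eq_right h']; linarith
      · rw [max_eq_left h']; linarith
    · have := sq_nonneg ‖a‖
      rw [Real.sq_sqrt h, max_eq_left (show (0 : ℝ) ≤ R by linarith), max_eq_left h]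
  rw [e2]
  ring

/-- After `x = ρ²` the weight is `(1 - x) - max (q - x) 0`; each piece falls under
`integral_sub_mul_halfSecondDeriv`, with upper limit `1` and `q`. -/
theorem integral_Ioo_profile {g : ℂ → ℂ} (hg : DifferentiableOn ℂ g (ball 0 1))
    {α q : ℝ} (hα : 0 ≤ α) (hα1 : α < 1) (hq : 0 ≤ q) (hq1 : q < 1) :
    ∫ ρ in Ioo (0 : ℝ) 1, (2 * π * ρ : ℝ) •
        (((π * (1 - ρ ^ 2 - max (q - ρ ^ 2) 0) : ℝ) : ℂ) * halfSecondDeriv g (α * ρ ^ 2 : ℝ))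
      = (π ^ 2 / 2 : ℝ) * (g (α : ℝ) - q ^ 2 * g (q * α : ℝ)) := by
  have hN : ContinuousOn (fun x : ℝ => halfSecondDeriv g (α * x : ℝ)) (Icc 0 1) := by
    refine (differentiableOn_halfSecondDeriv hg).continuousOn.comp (by fun_prop) fun x hx => ?_
    rw [mem_ball_zero_iff, Complex.norm_real, Real.norm_of_nonneg (mul_nonneg hα hx.1)]
    nlinarith [hx.1, hx.2]
  set G : ℝ → ℂ := fun x => ((π ^ 2 * (1 - x - max (q - x) 0) : ℝ) : ℂ)
    * halfSecondDeriv g (α * x : ℝ) with hG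
  have hGc : ContinuousOn G (Icc 0 1) := by
    refine ContinuousOn.mul (Continuous.continuousOn ?_) hN
    fun_prop
  have hsub := intervalIntegral.integral_deriv_smul_comp'' (a := 0) (b := 1)
    (f := fun x : ℝ => x ^ 2) (f' := fun x => 2 * x) (g := G) (by fun_prop)
    (fun x _ => by simpa using (hasDerivAt_pow 2 x).hasDerivWithinAt) (by fun_prop)
    (hGc.mono (by
      rintro _ ⟨x, hx, rfl⟩
      rw [uIcc_of_le zero_le_one] at hx
      exact ⟨by positivity, pow_le_one₀ hx.1 hx.2⟩))
  rw [← integral_Ioc_eq_integral_Ioo, ← intervalIntegral.integral_of_le zero_le_one]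
  have e1 : (fun ρ : ℝ => (2 * π * ρ : ℝ) • (((π * (1 - ρ ^ 2 - max (q - ρ ^ 2) 0) : ℝ) : ℂ)
      * halfSecondDeriv g (α * ρ ^ 2 : ℝ)))
      = fun x => (2 * x) • (G ∘ fun x : ℝ => x ^ 2) x := by
    funext x
    simp only [hG, Function.comp_apply, Complex.real_smul]
    push_cast
    ring
  rw [e1, hsub]
  norm_num only
  have hsplit : G = fun x => (π ^ 2 : ℝ) * (((1 - x : ℝ) : ℂ) * halfSecondDeriv g (α * x : ℝ))
      - (π ^ 2 : ℝ) * (((max (q - x) 0 : ℝ) : ℂ) * halfSecondDeriv g (α * x : ℝ)) := by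
    funext x
    simp only [hG]
    push_cast
    ring
  have hic : ∀ u : ℝ → ℝ, Continuous u → ∀ s t : ℝ, s ∈ Icc (0 : ℝ) 1 → t ∈ Icc (0 : ℝ) 1 →
      IntervalIntegrable (fun x => ((u x : ℝ) : ℂ) * halfSecondDeriv g (α * x : ℝ)) volume s t :=
    fun u hu s t hs ht => ContinuousOn.intervalIntegrable
      ((Continuous.continuousOn (by fun_prop)).mul (hN.mono (uIcc_subset_Icc hs ht)))
  have m0 : (0 : ℝ) ∈ Icc (0 : ℝ) 1 := by simp
  have m1 : (1 : ℝ) ∈ Icc (0 : ℝ) 1 := by simp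
  have mq : q ∈ Icc (0 : ℝ) 1 := ⟨hq, hq1.le⟩
  have e2 : ∫ x in (0 : ℝ)..1, ((max (q - x) 0 : ℝ) : ℂ) * halfSecondDeriv g (α * x : ℝ)
      = q ^ 2 * g (q * α : ℝ) / 2 := by
    rw [← integral_sub_mul_halfSecondDeriv hg hα hα1 hq hq1.le,
      ← intervalIntegral.integral_add_adjacent_intervals
        (hic (fun x => max (q - x) 0) (by fun_prop) 0 q m0 mq)
        (hic (fun x => max (q - x) 0) (by fun_prop) q 1 mq m1)]
    have z1 : ∫ x in q..1, ((max (q - x) 0 : ℝ) : ℂ) * halfSecondDeriv g (α * x : ℝ) = 0 := by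
      refine (intervalIntegral.integral_congr (g := fun _ => 0) fun x hx => ?_).trans
        intervalIntegral.integral_zero
      rw [uIcc_of_le hq1.le] at hx
      simp [max_eq_right (sub_nonpos.2 hx.1)]
    rw [z1, add_zero]
    refine intervalIntegral.integral_congr fun x hx => ?_
    rw [uIcc_of_le hq] at hx
    simp only [max_eq_left (sub_nonneg.2 hx.2)]
  have e3 := integral_sub_mul_halfSecondDeriv hg hα hα1 zero_le_one le_rfl
  rw [hsplit, intervalIntegral.integral_sub
    ((hic (fun x => 1 - x) (by fun_prop) 0 1 m0 m1).const_mul _)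
    ((hic (fun x => max (q - x) 0) (by fun_prop) 0 1 m0 m1).const_mul _),
    intervalIntegral.integral_const_mul, intervalIntegral.integral_const_mul, e2, e3]
  push_cast
  rw [one_mul]
  ring

/-- Fubini: the second variable yields slice area times slice mean, and polar coordinates in the
first reduce the rest to `circleAverage_mul_conj_kernel` and `integral_Ioo_profile`. The subtracted
term is the contribution of the hole. -/
theorem integral_shell_mul_conj {f : ℂ × ℂ → ℂ} {R : ℝ} (hR : R < 1)
    (hf : DifferentiableOn ℂ f (shell R)) (hi : IntegrableOn f (shell R)) {α : ℝ} (hα : 0 ≤ α)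
    (hα1 : α < 1) :
    ∫ z in shell R, f z * (starRingEnd ℂ) (1 / (1 - α * z.1) ^ 3)
      = (π ^ 2 / 2 : ℝ) * (sliceMean f R (α : ℝ)
        - (max R 0 : ℝ) ^ 2 * sliceMean f R (max R 0 * α : ℝ)) := by
  classical
  set h : ℂ → ℂ := fun a => (starRingEnd ℂ) (1 / (1 - α * a) ^ 3) with hh
  have hne : ∀ a : ℂ, ‖a‖ < 1 → 1 - α ≤ ‖1 - α * a‖ := fun a ha => by
    have h1 := norm_sub_norm_le (1 : ℂ) (α * a)
    rw [norm_one, norm_mul, Complex.norm_real, Real.norm_of_nonneg hα] at h1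
    nlinarith [norm_nonneg a]
  have hne' : ∀ a : ℂ, ‖a‖ < 1 → 1 - α * a ≠ 0 := fun a ha h0 => by
    have := hne a ha
    rw [h0, norm_zero] at this; linarith
  have hhc : ContinuousOn h (ball 0 1) := by
    refine Complex.continuous_conj.comp_continuousOn (continuousOn_const.div (by fun_prop) ?_)
    exact fun a ha => pow_ne_zero _ (hne' a (by simpa using ha))
  have hhb : ∀ a : ℂ, ‖a‖ < 1 → ‖h a‖ ≤ 1 / (1 - α) ^ 3 := fun a ha => by
    have h0 : 0 < 1 - α := by linarith
    rw [hh, RCLike.norm_conj, norm_div, norm_one, norm_pow]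
    exact one_div_le_one_div_of_le (by positivity) (pow_le_pow_left₀ h0.le (hne a ha) 3)
  have hfst : ∀ z ∈ shell R, ‖z.1‖ < 1 := fun z hz => by
    nlinarith [hz.2, norm_nonneg z.1, sq_nonneg ‖z.2‖]
  set F := (shell R).indicator f with hF
  have hFi : Integrable F := (integrable_indicator_iff (isOpen_shell R).measurableSet).2 hi
  have hPe : (fun z : ℂ × ℂ => F z * h z.1) = (shell R).indicator fun z => f z * h z.1 := by
    funext z
    by_cases hz : z ∈ shell R <;> simp [hF, hz]
  have hPi : Integrable fun z : ℂ × ℂ => F z * h z.1 := by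
    rw [hPe, integrable_indicator_iff (isOpen_shell R).measurableSet]
    refine Integrable.mul_bdd (c := 1 / (1 - α) ^ 3) hi ?_ ?_
    · refine ContinuousOn.aestronglyMeasurable ?_ (isOpen_shell R).measurableSet
      exact hhc.comp continuousOn_fst fun z hz => by simpa using hfst z hz
    · exact (ae_restrict_iff' (isOpen_shell R).measurableSet).2
        (Eventually.of_forall fun z hz => hhb _ (hfst z hz))
  set Φ : ℂ → ℂ := (ball (0 : ℂ) 1).indicator fun a =>
    ((π * (1 - ‖a‖ ^ 2 - max (max R 0 - ‖a‖ ^ 2) 0) : ℝ) : ℂ) * sliceMean f R a * h a with hΦ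
  have hG := differentiableOn_sliceMean hR hf
  have hae : (fun a => ∫ b, F (a, b) * h a) =ᵐ[volume] Φ := by
    filter_upwards [hFi.prod_right_ae] with a ha
    rw [integral_mul_const]
    by_cases ha1 : ‖a‖ < 1
    · rw [hΦ, indicator_of_mem (by simpa using ha1), integral_slice hR hf ha1 ha]
    · rw [hΦ, indicator_of_notMem (by simpa using ha1)]
      have : ∀ b, F (a, b) = 0 := fun b => indicator_of_notMem (fun hb => ha1 (hfst _ hb)) _
      simp [this]
  have hΦm : Measurable Φ := by
    rw [hΦ, ← Set.piecewise_eq_indicator]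
    refine ContinuousOn.measurable_piecewise ?_ continuousOn_const isOpen_ball.measurableSet
    have := hG.continuousOn
    have h2 : ContinuousOn (fun a : ℂ =>
      ((π * (1 - ‖a‖ ^ 2 - max (max R 0 - ‖a‖ ^ 2) 0) : ℝ) : ℂ)) (ball 0 1) := by fun_prop
    exact (h2.mul this).mul hhc
  have hΦi : Integrable Φ := hPi.integral_prod_left.congr hae
  have hcirc : ∀ ρ ∈ Ioi (0 : ℝ), (2 * π * ρ : ℝ) • circleAverage Φ 0 ρ
      = (Ioo (0 : ℝ) 1).indicator (fun ρ => (2 * π * ρ : ℝ) •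
        (((π * (1 - ρ ^ 2 - max (max R 0 - ρ ^ 2) 0) : ℝ) : ℂ)
          * halfSecondDeriv (sliceMean f R) (α * ρ ^ 2 : ℝ))) ρ := fun ρ hρ => by
    have hρ0 : 0 < ρ := hρ
    by_cases h1 : ρ < 1
    · rw [indicator_of_mem (show ρ ∈ Ioo (0 : ℝ) 1 from ⟨hρ0, h1⟩), ← circleAverage_mul_conj_kernel hG hρ0 h1 hα hα1]
      congr 1
      rw [← smul_eq_mul, ← circleAverage_fun_smul]
      refine circleAverage_congr_sphere fun w hw => ?_
      have hw : ‖w‖ = ρ := by simpa [abs_of_pos hρ0] using hw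
      rw [hΦ, indicator_of_mem (by simp [hw, h1])]
      simp only [hw, smul_eq_mul, mul_assoc, hh]
    · rw [indicator_of_notMem fun h => h1 h.2]
      have : circleAverage Φ 0 ρ = circleAverage (fun _ => 0) 0 ρ := by
        refine circleAverage_congr_sphere fun w hw => indicator_of_notMem (fun hw' => h1 ?_) _
        have hw : ‖w‖ = ρ := by simpa [abs_of_pos hρ0] using hw
        simpa [hw] using hw'
      rw [this, circleAverage_const, smul_zero]
  calc ∫ z in shell R, f z * h z.1 = ∫ z : ℂ × ℂ, F z * h z.1 := by
        rw [hPe, integral_indicator (isOpen_shell R).measurableSet]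
    _ = ∫ a, ∫ b, F (a, b) * h a := by
        rw [Measure.volume_eq_prod, integral_prod _ (by rwa [← Measure.volume_eq_prod])]
    _ = ∫ a, Φ a := integral_congr_ae hae
    _ = _ := by
        rw [integral_eq_integral_circleAverage hΦm hΦi,
          setIntegral_congr_fun measurableSet_Ioi hcirc, setIntegral_indicator measurableSet_Ioo,
          show Ioi (0 : ℝ) ∩ Ioo 0 1 = Ioo 0 1 from inter_eq_right.2 fun x hx => hx.1,
          integral_Ioo_profile hG hα hα1 (le_max_right _ _) (max_lt hR one_pos)]

/-! ### The Bergman kernel of a shell. -/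

theorem one_sub_le_norm_one_sub_mul {c : ℂ} (hc : ‖c‖ ≤ 1) (x : ℂ) : 1 - ‖x‖ ≤ ‖1 - c * x‖ := by
  have h1 := norm_sub_norm_le (1 : ℂ) (c * x)
  rw [norm_one, norm_mul] at h1
  nlinarith [norm_nonneg x]

/-- The terms of the series for the Bergman kernel of a shell, up to a constant. -/
def kernelTerm (q : ℝ) (j : ℕ) (x : ℂ) : ℂ := (q : ℂ) ^ (2 * j) / (1 - (q : ℂ) ^ j * x) ^ 3

/-- The Bergman kernel of the shell `{q < |z|² < 1}` in terms of `⟪w, z⟫`. -/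
def shellKernel (q : ℝ) (x : ℂ) : ℂ := (2 / π ^ 2 : ℝ) * ∑' j, kernelTerm q j x

theorem norm_ofReal_pow_le_one {q : ℝ} (hq : 0 ≤ q) (hq1 : q < 1) (j : ℕ) :
    ‖(q : ℂ) ^ j‖ ≤ 1 := by
  rw [norm_pow, Complex.norm_real, Real.norm_of_nonneg hq]
  exact pow_le_one₀ hq hq1.le

theorem norm_kernelTerm_le {q : ℝ} (hq : 0 ≤ q) (hq1 : q < 1) (j : ℕ) {x : ℂ} {s : ℝ}
    (hx : ‖x‖ ≤ s) (hs : s < 1) : ‖kernelTerm q j x‖ ≤ (q ^ 2) ^ j * (1 / (1 - s) ^ 3) := by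
  have h1 := one_sub_le_norm_one_sub_mul (norm_ofReal_pow_le_one hq hq1 j) x
  have h0 : 0 < 1 - s := by linarith
  rw [kernelTerm, norm_div, norm_pow, norm_pow, Complex.norm_real, Real.norm_of_nonneg hq, ← pow_mul,
    div_eq_mul_one_div]
  gcongr
  linarith

theorem summable_kernelTerm_bound {q : ℝ} (hq : 0 ≤ q) (hq1 : q < 1) (c : ℝ) :
    Summable fun j : ℕ => (q ^ 2) ^ j * c :=
  (summable_geometric_of_lt_one (by positivity) (by nlinarith)).mul_right _

theorem summable_kernelTerm {q : ℝ} (hq : 0 ≤ q) (hq1 : q < 1) {x : ℂ} (hx : ‖x‖ < 1) :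
    Summable fun j => kernelTerm q j x :=
  Summable.of_norm_bounded (summable_kernelTerm_bound hq hq1 _)
    fun j => norm_kernelTerm_le hq hq1 j le_rfl hx

theorem differentiableOn_kernelTerm {q : ℝ} (hq : 0 ≤ q) (hq1 : q < 1) (j : ℕ) :
    DifferentiableOn ℂ (kernelTerm q j) (ball 0 1) := by
  unfold kernelTerm
  refine (differentiableOn_const _).div (by fun_prop) fun x hx => pow_ne_zero _ fun h0 => ?_
  have := one_sub_le_norm_one_sub_mul (norm_ofReal_pow_le_one hq hq1 j) x
  rw [mem_ball_zero_iff] at hx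
  rw [h0, norm_zero] at this
  linarith

theorem differentiableOn_shellKernel {q : ℝ} (hq : 0 ≤ q) (hq1 : q < 1) :
    DifferentiableOn ℂ (shellKernel q) (ball 0 1) := by
  intro x hx
  rw [mem_ball_zero_iff] at hx
  obtain ⟨s, hxs, hs⟩ := exists_between hx
  have h := Complex.differentiableOn_tsum_of_summable_norm (summable_kernelTerm_bound hq hq1 _)
    (fun j => (differentiableOn_kernelTerm hq hq1 j).mono (ball_subset_ball hs.le)) isOpen_ball
    (fun j w hw => norm_kernelTerm_le hq hq1 j (mem_ball_zero_iff.1 hw).le hs)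
  have := (h.differentiableAt (isOpen_ball.mem_nhds (mem_ball_zero_iff.2 hxs))).const_mul
    ((2 / π ^ 2 : ℝ) : ℂ)
  exact this.differentiableWithinAt

/-- The shell `{R < |z|² < 1}` in the Euclidean space `ℂ²`. -/
def euclideanShell (R : ℝ) : Set (EuclideanSpace ℂ (Fin 2)) := {z | R < ‖z‖ ^ 2 ∧ ‖z‖ ^ 2 < 1}

theorem isOpen_euclideanShell (R : ℝ) : IsOpen (euclideanShell R) := by
  have hc : Continuous fun z : EuclideanSpace ℂ (Fin 2) => ‖z‖ ^ 2 := by fun_prop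
  exact (isOpen_lt continuous_const hc).inter (isOpen_lt hc continuous_const)

theorem norm_lt_one_of_mem_euclideanShell {R : ℝ} {z : EuclideanSpace ℂ (Fin 2)}
    (hz : z ∈ euclideanShell R) : ‖z‖ < 1 := by
  nlinarith [hz.2, norm_nonneg z]

/-- Coordinates on `ℂ²` with respect to a unit vector `u` and its unit normal. -/
def frame (u : EuclideanSpace ℂ (Fin 2)) (p : ℂ × ℂ) : EuclideanSpace ℂ (Fin 2) :=
  WithLp.toLp 2 ![p.1 * u 0 - p.2 * (starRingEnd ℂ) (u 1), p.1 * u 1 + p.2 * (starRingEnd ℂ) (u 0)]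

theorem differentiable_frame (u : EuclideanSpace ℂ (Fin 2)) : Differentiable ℂ (frame u) := by
  refine (PiLp.continuousLinearEquiv 2 ℂ (fun _ : Fin 2 => ℂ)).symm.differentiable.comp
    (differentiable_pi.2 fun i => ?_)
  fin_cases i
  · change Differentiable ℂ fun p : ℂ × ℂ => p.1 * u 0 - p.2 * (starRingEnd ℂ) (u 1)
    fun_prop
  · change Differentiable ℂ fun p : ℂ × ℂ => p.1 * u 1 + p.2 * (starRingEnd ℂ) (u 0)
    fun_prop

theorem normSq_frame {u : EuclideanSpace ℂ (Fin 2)} (hu : ‖u‖ = 1) (p : ℂ × ℂ) :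
    ‖frame u p‖ ^ 2 = ‖p.1‖ ^ 2 + ‖p.2‖ ^ 2 := by
  have h1 : ‖u 0‖ ^ 2 + ‖u 1‖ ^ 2 = 1 := by
    have := EuclideanSpace.norm_sq_eq u
    rw [hu, Fin.sum_univ_two] at this; linarith
  rw [EuclideanSpace.norm_sq_eq, Fin.sum_univ_two]
  simp only [frame, Matrix.cons_val_zero, Matrix.cons_val_one]
  simp only [← Complex.normSq_eq_norm_sq, Complex.normSq_apply] at h1 ⊢
  simp
  linear_combination ((p.1.re) ^ 2 + p.1.im ^ 2 + p.2.re ^ 2 + p.2.im ^ 2) * h1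

/-- For `w` a multiple of `u`, this makes the kernel a function of the first frame coordinate alone.
-/
theorem inner_frame {u : EuclideanSpace ℂ (Fin 2)} (hu : ‖u‖ = 1) (p : ℂ × ℂ) :
    inner ℂ u (frame u p) = p.1 := by
  have h1 : u 0 * (starRingEnd ℂ) (u 0) + u 1 * (starRingEnd ℂ) (u 1) = 1 := by
    have := EuclideanSpace.norm_sq_eq u
    rw [hu, Fin.sum_univ_two, one_pow] at this
    have h2 : ((‖u 0‖ ^ 2 + ‖u 1‖ ^ 2 : ℝ) : ℂ) = 1 := by rw [← this, Complex.ofReal_one]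
    rw [Complex.mul_conj', Complex.mul_conj', ← h2]
    push_cast
    rfl
  rw [PiLp.inner_apply, Fin.sum_univ_two]
  simp only [frame, RCLike.inner_apply, Matrix.cons_val_zero, Matrix.cons_val_one]
  linear_combination p.1 * h1

/-- `frame u` as a real linear isometry. -/
def frameIsometry {u : EuclideanSpace ℂ (Fin 2)} (hu : ‖u‖ = 1) :
    WithLp 2 (ℂ × ℂ) ≃ₗᵢ[ℝ] EuclideanSpace ℂ (Fin 2) :=
  LinearIsometry.toLinearIsometryEquiv
    { toFun := fun p => frame u p.ofLp
      map_add' := fun p p' => by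
        ext i; fin_cases i <;> simp [frame] <;> ring_nf
      map_smul' := fun c p => by
        ext i; fin_cases i <;> simp [frame, mul_sub, mul_assoc]
      norm_map' := fun p => by
        have h := normSq_frame hu p.ofLp
        have h2 := WithLp.prod_norm_sq_eq_of_L2 p
        refine (sq_eq_sq₀ (norm_nonneg _) (norm_nonneg _)).1 ?_
        simp only [LinearMap.coe_mk, AddHom.coe_mk]
        rw [h, h2]
        rfl }
    (by
      rw [(WithLp.linearEquiv 2 ℝ (ℂ × ℂ)).finrank_eq,
        (WithLp.linearEquiv 2 ℝ (Fin 2 → ℂ)).finrank_eq,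
        Module.finrank_pi_fintype]
      simp)

theorem measurePreserving_frame {u : EuclideanSpace ℂ (Fin 2)} (hu : ‖u‖ = 1) :
    MeasurePreserving (frame u) :=
  (frameIsometry hu).measurePreserving.comp (WithLp.volume_preserving_toLp ℂ ℂ)

theorem measurableEmbedding_frame {u : EuclideanSpace ℂ (Fin 2)} (hu : ‖u‖ = 1) :
    MeasurableEmbedding (frame u) :=
  (frameIsometry hu).toHomeomorph.measurableEmbedding.comp
    (MeasurableEquiv.toLp 2 (ℂ × ℂ)).measurableEmbedding

theorem preimage_frame {u : EuclideanSpace ℂ (Fin 2)} (hu : ‖u‖ = 1) (R : ℝ) :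
    frame u ⁻¹' euclideanShell R = shell R := by
  ext p
  simp only [euclideanShell, shell, mem_preimage, mem_ofPred_eq, normSq_frame hu]

theorem exists_unit_smul (w : EuclideanSpace ℂ (Fin 2)) :
    ∃ u : EuclideanSpace ℂ (Fin 2), ‖u‖ = 1 ∧ w = (‖w‖ : ℂ) • u := by
  by_cases h : w = 0
  · exact ⟨EuclideanSpace.single 0 1, by simp, by simp [h]⟩
  · have h' : (‖w‖ : ℂ) ≠ 0 := by simpa using h
    refine ⟨(‖w‖ : ℂ)⁻¹ • w, ?_, by rw [smul_smul, mul_inv_cancel₀ h', one_smul]⟩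
    rw [norm_smul, norm_inv, Complex.norm_real, norm_norm, inv_mul_cancel₀ (by simpa using h)]

/-- Telescoping: with `α = q^j s`, the `j`-th term integrates to the difference of consecutive
values of `q^(2j) G(q^j s)`. -/
theorem integral_shell_mul_conj_shellKernel {g : ℂ × ℂ → ℂ} {R s : ℝ} (hR : R < 1)
    (hg : DifferentiableOn ℂ g (shell R)) (hi : IntegrableOn g (shell R)) (hs : 0 ≤ s)
    (hRs : R < s ^ 2) (hs1 : s < 1) :
    ∫ z in shell R, g z * (starRingEnd ℂ) (shellKernel (max R 0) (s * z.1)) = g (s, 0) := by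
  set q := max R 0 with hq
  have hq0 : 0 ≤ q := le_max_right _ _
  have hq1 : q < 1 := max_lt hR one_pos
  have hG := differentiableOn_sliceMean hR hg
  set G := sliceMean g R with hGdef
  have hfst : ∀ z ∈ shell R, ‖z.1‖ ≤ 1 := fun z hz => by
    nlinarith [hz.2, norm_nonneg z.1, sq_nonneg ‖z.2‖]
  have hsz : ∀ z ∈ shell R, ‖(s : ℂ) * z.1‖ ≤ s := fun z hz => by
    rw [norm_mul, Complex.norm_real, Real.norm_of_nonneg hs]
    exact mul_le_of_le_one_right hs (hfst z hz)
  have hmeas := (isOpen_shell R).measurableSet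
  have hαlt : ∀ j : ℕ, q ^ j * s < 1 := fun j =>
    lt_of_le_of_lt (mul_le_of_le_one_left hs (pow_le_one₀ hq0 hq1.le)) hs1
  have hterm : ∀ j : ℕ, ∫ z in shell R, g z * (starRingEnd ℂ) (kernelTerm q j (s * z.1))
      = (π ^ 2 / 2 : ℝ) * ((q ^ 2 : ℂ) ^ j * G (q ^ j * s : ℝ)
        - (q ^ 2 : ℂ) ^ (j + 1) * G (q ^ (j + 1) * s : ℝ)) := fun j => by
    have h := integral_shell_mul_conj hR hg hi (mul_nonneg (pow_nonneg hq0 j) hs) (hαlt j)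
    have e : ∀ z : ℂ × ℂ, g z * (starRingEnd ℂ) (kernelTerm q j (s * z.1))
        = (q ^ 2 : ℂ) ^ j *
          (g z * (starRingEnd ℂ) (1 / (1 - ((q ^ j * s : ℝ) : ℂ) * z.1) ^ 3)) := fun z => by
      rw [kernelTerm, div_eq_mul_one_div, map_mul, map_pow, Complex.conj_ofReal, ← pow_mul]
      push_cast
      rw [mul_left_comm, mul_assoc ((q : ℂ) ^ j)]
    simp_rw [e]
    rw [integral_const_mul, h, ← hq, ← mul_assoc q, ← pow_succ']
    push_cast
    ring
  have hint : ∀ j : ℕ, IntegrableOn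
      (fun z => g z * (starRingEnd ℂ) (kernelTerm q j (s * z.1))) (shell R) := fun j => by
    refine Integrable.mul_bdd (c := (q ^ 2) ^ j * (1 / (1 - s) ^ 3)) hi ?_ ?_
    · refine ContinuousOn.aestronglyMeasurable ?_ hmeas
      refine Complex.continuous_conj.comp_continuousOn
        ((differentiableOn_kernelTerm hq0 hq1 j).continuousOn.comp (by fun_prop) fun z hz => ?_)
      exact mem_ball_zero_iff.2 ((hsz z hz).trans_lt hs1)
    · refine (ae_restrict_iff' hmeas).2 (Eventually.of_forall fun z hz => ?_)
      rw [RCLike.norm_conj]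
      exact norm_kernelTerm_le hq0 hq1 j (hsz z hz) hs1
  have hsum : Summable fun j : ℕ =>
      ∫ z in shell R, ‖g z * (starRingEnd ℂ) (kernelTerm q j (s * z.1))‖ := by
    refine Summable.of_nonneg_of_le (fun j => integral_nonneg fun z => norm_nonneg _) (fun j => ?_)
      (summable_kernelTerm_bound hq0 hq1 (1 / (1 - s) ^ 3 * ∫ z in shell R, ‖g z‖))
    rw [← mul_assoc, ← integral_const_mul]
    refine setIntegral_mono_on (hint j).norm (hi.norm.const_mul _) hmeas fun z hz => ?_
    rw [norm_mul, RCLike.norm_conj, mul_comm]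
    exact mul_le_mul_of_nonneg_right (norm_kernelTerm_le hq0 hq1 j (hsz z hz) hs1) (norm_nonneg _)
  have hS := (hasSum_integral_of_summable_integral_norm hint hsum).tendsto_sum_nat
  simp_rw [hterm] at hS
  have hpart : ∀ n : ℕ, ∑ j ∈ Finset.range n, ((π ^ 2 / 2 : ℝ) : ℂ) *
      ((q ^ 2 : ℂ) ^ j * G (q ^ j * s : ℝ) - (q ^ 2 : ℂ) ^ (j + 1) * G (q ^ (j + 1) * s : ℝ))
      = (π ^ 2 / 2 : ℝ) * (G s - (q ^ 2 : ℂ) ^ n * G (q ^ n * s : ℝ)) := fun n => by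
    rw [← Finset.mul_sum,
      Finset.sum_range_sub' (fun j => (q ^ 2 : ℂ) ^ j * G (q ^ j * s : ℝ))]
    simp
  simp_rw [hpart] at hS
  -- The remainder vanishes because `G` is continuous at `0`, a point available only thanks to the
  -- extension across the hole.
  have hlim : Tendsto (fun n : ℕ => ((π ^ 2 / 2 : ℝ) : ℂ) *
      (G s - (q ^ 2 : ℂ) ^ n * G (q ^ n * s : ℝ))) atTop
      (𝓝 ((π ^ 2 / 2 : ℝ) * (G s - 0 * G (0 * s : ℝ)))) := by
    refine tendsto_const_nhds.mul (tendsto_const_nhds.sub (Tendsto.mul ?_ ?_))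
    · refine tendsto_pow_atTop_nhds_zero_of_norm_lt_one ?_
      rw [norm_pow, Complex.norm_real, Real.norm_of_nonneg hq0]
      nlinarith
    · have h0 : ContinuousAt G ((0 * s : ℝ) : ℂ) :=
        (hG.differentiableAt (isOpen_ball.mem_nhds (by simp))).continuousAt
      exact h0.tendsto.comp ((Complex.continuous_ofReal.tendsto _).comp
        ((tendsto_pow_atTop_nhds_zero_of_lt_one hq0 hq1).mul_const s))
  have huniq := tendsto_nhds_unique hS hlim
  have hGs : G s = g (s, 0) := sliceMean_eq hg ⟨by simpa using hRs,
    by simpa [abs_of_nonneg hs] using hs1⟩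
  have e : ∀ z : ℂ × ℂ, g z * (starRingEnd ℂ) (shellKernel q (s * z.1))
      = (2 / π ^ 2 : ℝ) * ∑' j, g z * (starRingEnd ℂ) (kernelTerm q j (s * z.1)) := fun z => by
    rw [tsum_mul_left, shellKernel, map_mul, Complex.conj_ofReal, Complex.conj_tsum]
    ring
  simp_rw [e]
  rw [integral_const_mul, huniq, zero_mul, sub_zero, hGs, ← mul_assoc, ← Complex.ofReal_mul]
  have : (2 / π ^ 2 * (π ^ 2 / 2) : ℝ) = 1 := by
    have := pi_ne_zero
    field_simp
  rw [this, Complex.ofReal_one, one_mul]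

theorem isBergmanKernel_euclideanShell {R : ℝ} (hR : R < 1) :
    IsBergmanKernel (euclideanShell R) fun z w => shellKernel (max R 0) (inner ℂ w z) := by
  intro w hw
  have hw1 := norm_lt_one_of_mem_euclideanShell hw
  have hq0 : 0 ≤ max R 0 := le_max_right _ _
  have hq1 : max R 0 < 1 := max_lt hR one_pos
  have hmeas := (isOpen_euclideanShell R).measurableSet
  have : IsFiniteMeasure (volume.restrict (euclideanShell R)) := by
    refine ⟨?_⟩
    rw [Measure.restrict_apply_univ]
    exact (measure_mono fun z hz => mem_ball_zero_iff.2
      (norm_lt_one_of_mem_euclideanShell hz)).trans_lt (measure_ball_lt_top (x := 0) (r := 1))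
  have hinner : ∀ z ∈ euclideanShell R, ‖(inner ℂ w z : ℂ)‖ ≤ ‖w‖ := fun z hz =>
    (norm_inner_le_norm w z).trans
      (mul_le_of_le_one_right (norm_nonneg _) (norm_lt_one_of_mem_euclideanShell hz).le)
  have hK := differentiableOn_shellKernel hq0 hq1
  have hKd : DifferentiableOn ℂ (fun z => shellKernel (max R 0) (inner ℂ w z))
      (euclideanShell R) :=
    hK.comp (innerSL ℂ w).differentiable.differentiableOn
      fun z hz => mem_ball_zero_iff.2 ((hinner z hz).trans_lt hw1)
  refine ⟨⟨hKd, ?_⟩, fun f hf => ?_⟩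
  · obtain ⟨C, hC⟩ := (isCompact_closedBall (0 : ℂ) ‖w‖).exists_bound_of_continuousOn
      (hK.continuousOn.mono (closedBall_subset_ball hw1))
    refine MemLp.of_bound (hKd.continuousOn.aestronglyMeasurable hmeas) C ?_
    exact (ae_restrict_iff' hmeas).2 (Eventually.of_forall fun z hz =>
      hC _ (mem_closedBall_zero_iff.2 (hinner z hz)))
  · obtain ⟨u, hu, hwu⟩ := exists_unit_smul w
    have hfi : IntegrableOn f (euclideanShell R) := hf.2.integrable one_le_two
    have hgi : IntegrableOn (f ∘ frame u) (shell R) := by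
      rw [← preimage_frame hu]
      exact ((measurePreserving_frame hu).integrableOn_comp_preimage
        (measurableEmbedding_frame hu)).2 hfi
    have hgd : DifferentiableOn ℂ (f ∘ frame u) (shell R) := by
      refine hf.1.comp (differentiable_frame u).differentiableOn fun p hp => ?_
      rwa [← mem_preimage, preimage_frame hu]
    have hmain := integral_shell_mul_conj_shellKernel hR hgd hgi (norm_nonneg w) hw.1 hw1
    rw [← (measurePreserving_frame hu).setIntegral_preimage_emb (measurableEmbedding_frame hu),
      preimage_frame hu]
    have hin : ∀ p, (inner ℂ w (frame u p) : ℂ) = ‖w‖ * p.1 := fun p => by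
      conv_lhs => rw [hwu]
      rw [inner_smul_left, inner_frame hu, Complex.conj_ofReal]
    have hw0 : frame u (‖w‖, 0) = w := by
      conv_rhs => rw [hwu]
      ext i; fin_cases i <;> simp [frame]
    simp only [hin]
    rw [Function.comp_apply, hw0] at hmain
    exact hmain.symm

/-! ### The Bergman metric of a radial potential. -/

theorem hasFDerivAt_ofReal_comp_norm_sq {n : ℕ} {L : ℝ → ℝ} {L' : ℝ}
    {z : EuclideanSpace ℂ (Fin n)} (h : HasDerivAt L L' (‖z‖ ^ 2)) :
    HasFDerivAt (fun z : EuclideanSpace ℂ (Fin n) => ((L (‖z‖ ^ 2) : ℝ) : ℂ))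
      (Complex.ofRealCLM.comp (L' • (2 • innerSL ℝ z))) z :=
  Complex.ofRealCLM.hasFDerivAt.comp z (h.comp_hasFDerivAt z (hasStrictFDerivAt_norm_sq z).hasFDerivAt)

theorem inner_single_one {n : ℕ} (z : EuclideanSpace ℂ (Fin n)) (ν : Fin n) :
    inner ℝ z (EuclideanSpace.single ν (1 : ℂ)) = (z ν).re := by
  rw [PiLp.inner_apply, Finset.sum_eq_single ν]
  · simp [Complex.inner]
  · intro i _ hi; simp [hi]
  · simp

theorem inner_single_I {n : ℕ} (z : EuclideanSpace ℂ (Fin n)) (ν : Fin n) :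
    inner ℝ z (EuclideanSpace.single ν Complex.I) = (z ν).im := by
  rw [PiLp.inner_apply, Finset.sum_eq_single ν]
  · simp [Complex.inner]
  · intro i _ hi; simp [hi]
  · simp

theorem wirtingerBar_comp_norm_sq {n : ℕ} (μ : Fin n) {L : ℝ → ℝ} {L' : ℝ}
    {z : EuclideanSpace ℂ (Fin n)} (h : HasDerivAt L L' (‖z‖ ^ 2)) :
    wirtingerBar μ (fun z => ((L (‖z‖ ^ 2) : ℝ) : ℂ)) z = L' * z μ := by
  rw [wirtingerBar, (hasFDerivAt_ofReal_comp_norm_sq h).fderiv]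
  simp only [ContinuousLinearMap.comp_apply, smul_apply, innerSL_apply_apply,
    inner_single_one, inner_single_I, Complex.ofRealCLM_apply, smul_eq_mul, nsmul_eq_mul]
  conv_rhs => rw [← Complex.re_add_im (z μ)]
  push_cast
  ring

theorem wirtinger_mul_coord {n : ℕ} (ν μ : Fin n) {L : ℝ → ℝ} {L' : ℝ}
    {z : EuclideanSpace ℂ (Fin n)} (h : HasDerivAt L L' (‖z‖ ^ 2)) :
    wirtinger ν (fun z => ((L (‖z‖ ^ 2) : ℝ) : ℂ) * z μ) z
      = (if μ = ν then (L (‖z‖ ^ 2) : ℂ) else 0) + L' * (starRingEnd ℂ) (z ν) * z μ := by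
  have hp : HasFDerivAt (fun z : EuclideanSpace ℂ (Fin n) => z μ)
      ((EuclideanSpace.proj μ : EuclideanSpace ℂ (Fin n) →L[ℂ] ℂ).restrictScalars ℝ) z :=
    ((EuclideanSpace.proj μ : EuclideanSpace ℂ (Fin n) →L[ℂ] ℂ).restrictScalars ℝ).hasFDerivAt
  have e : (starRingEnd ℂ) (z ν) = (z ν).re - (z ν).im * Complex.I := by
    apply Complex.ext <;> simp
  have hproj : ∀ a : ℂ, (EuclideanSpace.proj μ : EuclideanSpace ℂ (Fin n) →L[ℂ] ℂ)
      (EuclideanSpace.single ν a) = if μ = ν then a else 0 := fun a => by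
    change (EuclideanSpace.single ν a : EuclideanSpace ℂ (Fin n)) μ = _
    rw [PiLp.single_apply]
  have hd : HasFDerivAt (fun z : EuclideanSpace ℂ (Fin n) => ((L (‖z‖ ^ 2) : ℝ) : ℂ) * z μ) _ z :=
    (hasFDerivAt_ofReal_comp_norm_sq h).mul hp
  rw [wirtinger, hd.fderiv, e]
  simp only [ContinuousLinearMap.comp_apply, smul_apply, innerSL_apply_apply,
    inner_single_one, inner_single_I, Complex.ofRealCLM_apply, smul_eq_mul, nsmul_eq_mul,
    add_apply, ContinuousLinearMap.coe_restrictScalars', hproj]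
  split_ifs
  · push_cast
    linear_combination (-(L (‖z‖ ^ 2) : ℂ) / 2) * Complex.I_mul_I
  · push_cast
    ring

/-- The complex Hessian of `L(|z|²)` is `L' δ_{νμ} + L'' z̄_ν z_μ`, which is diagonal at `(s, 0)`.
-/
theorem bergmanMetric_eq_sqrt {Ω : Set (EuclideanSpace ℂ (Fin 2))} {L L₁ : ℝ → ℝ} {L₂ s : ℝ}
    (hL : ∀ᶠ z in 𝓝 (!₂[(s : ℂ), 0] : EuclideanSpace ℂ (Fin 2)),
      logBergmanKernel Ω z = (L (‖z‖ ^ 2) : ℝ))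
    (hL₁ : ∀ᶠ t in 𝓝 (s ^ 2), HasDerivAt L (L₁ t) t) (hL₂ : HasDerivAt L₁ L₂ (s ^ 2))
    (ξ : EuclideanSpace ℂ (Fin 2)) :
    bergmanMetric Ω !₂[(s : ℂ), 0] ξ
      = √((L₁ (s ^ 2) + s ^ 2 * L₂) * ‖ξ 0‖ ^ 2 + L₁ (s ^ 2) * ‖ξ 1‖ ^ 2) := by
  set p : EuclideanSpace ℂ (Fin 2) := !₂[(s : ℂ), 0] with hp
  have hpn : ‖p‖ ^ 2 = s ^ 2 := by
    rw [EuclideanSpace.norm_sq_eq, Fin.sum_univ_two]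
    simp [hp]
  have hc : ContinuousAt (fun z : EuclideanSpace ℂ (Fin 2) => ‖z‖ ^ 2) p := by fun_prop
  have hL₁' : ∀ᶠ z in 𝓝 p, HasDerivAt L (L₁ (‖z‖ ^ 2)) (‖z‖ ^ 2) :=
    hc.eventually (p := fun t => HasDerivAt L (L₁ t) t) (by simpa only [hpn] using hL₁)
  have hbar : ∀ μ : Fin 2, wirtingerBar μ (logBergmanKernel Ω)
      =ᶠ[𝓝 p] fun z => ((L₁ (‖z‖ ^ 2) : ℝ) : ℂ) * z μ := fun μ => by
    filter_upwards [hL₁', hL.eventually_nhds] with z hz1 hz2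
    rw [← wirtingerBar_comp_norm_sq μ hz1, wirtingerBar, wirtingerBar,
      Filter.EventuallyEq.fderiv_eq hz2]
  have hw : ∀ ν μ : Fin 2, wirtinger ν (wirtingerBar μ (logBergmanKernel Ω)) p
      = (if μ = ν then (L₁ (s ^ 2) : ℂ) else 0) + L₂ * (starRingEnd ℂ) (p ν) * p μ :=
    fun ν μ => by
      rw [wirtinger, (hbar μ).fderiv_eq, ← wirtinger, wirtinger_mul_coord ν μ (by rwa [hpn]), hpn]
  have h0 : p 0 = s := rfl
  have h1 : p 1 = 0 := rfl
  rw [bergmanMetric]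
  congr 1
  simp only [hw, Fin.sum_univ_two, h0, h1]
  have e : ∀ a : ℂ, a * (starRingEnd ℂ) a = (‖a‖ ^ 2 : ℝ) := fun a => by
    rw [Complex.mul_conj']; push_cast; rfl
  have e2 : ∀ a b : ℂ, a * b * (starRingEnd ℂ) b = a * (‖b‖ ^ 2 : ℝ) := fun a b => by
    rw [mul_assoc, e]
  simp only [if_true, Complex.conj_ofReal, map_zero, mul_zero, zero_mul, add_zero, e2,
    if_neg (show (1 : Fin 2) ≠ 0 by decide), if_neg (show (0 : Fin 2) ≠ 1 by decide)]
  rw [← Complex.ofReal_re ((L₁ (s ^ 2) + s ^ 2 * L₂) * ‖ξ 0‖ ^ 2 + L₁ (s ^ 2) * ‖ξ 1‖ ^ 2)]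
  congr 1
  push_cast
  ring

/-! ### Signs and term-by-term differentiation of the kernel quotient. -/

/-- The cube of the ratio `(1 - t) / (1 - c t)`. -/
def ratioCube (c t : ℝ) : ℝ := (1 - t) ^ 3 / (1 - c * t) ^ 3

/-- The first derivative of `ratioCube c`. -/
def ratioCubeDeriv (c t : ℝ) : ℝ := -(3 * (1 - c) * (1 - t) ^ 2) / (1 - c * t) ^ 4

/-- The second derivative of `ratioCube c`. -/
def ratioCubeDeriv₂ (c t : ℝ) : ℝ :=
  6 * (1 - c) * (1 - t) / (1 - c * t) ^ 4 - 12 * c * (1 - c) * (1 - t) ^ 2 / (1 - c * t) ^ 5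

theorem two_thirds_le_one_sub_mul {c t : ℝ} (hc : c ∈ Icc (0 : ℝ) 1) (ht : t ∈ Ioo (0 : ℝ) (1 / 3)) :
    2 / 3 ≤ 1 - c * t := by
  nlinarith [hc.1, hc.2, ht.1, ht.2]

theorem hasDerivAt_ratioCube {c t : ℝ} (h : 1 - c * t ≠ 0) :
    HasDerivAt (ratioCube c) (ratioCubeDeriv c t) t := by
  have h1 : HasDerivAt (fun t : ℝ => 1 - t) (-1) t := by simpa using (hasDerivAt_id t).const_sub 1
  have h2 : HasDerivAt (fun t : ℝ => 1 - c * t) (-c) t := by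
    simpa using ((hasDerivAt_id t).const_mul c).const_sub 1
  refine ((h1.fun_pow 3).fun_div (h2.fun_pow 3) (pow_ne_zero 3 h)).congr_deriv ?_
  rw [ratioCubeDeriv, div_eq_div_iff (pow_ne_zero 2 (pow_ne_zero 3 h)) (pow_ne_zero 4 h)]
  push_cast
  ring

theorem hasDerivAt_ratioCubeDeriv {c t : ℝ} (h : 1 - c * t ≠ 0) :
    HasDerivAt (ratioCubeDeriv c) (ratioCubeDeriv₂ c t) t := by
  have h1 : HasDerivAt (fun t : ℝ => 1 - t) (-1) t := by simpa using (hasDerivAt_id t).const_sub 1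
  have h2 : HasDerivAt (fun t : ℝ => 1 - c * t) (-c) t := by
    simpa using ((hasDerivAt_id t).const_mul c).const_sub 1
  refine ((((h1.fun_pow 2).const_mul (3 * (1 - c))).fun_neg).fun_div (h2.fun_pow 4)
    (pow_ne_zero 4 h)).congr_deriv ?_
  rw [ratioCubeDeriv₂]
  field_simp
  push_cast
  ring

/-- `128` is a crude common bound for the ratio and its two derivatives; the largest quotient met is
`12 / (2/3)^5 < 92`. -/
theorem abs_ratioCubeDeriv_le {c t : ℝ} (hc : c ∈ Icc (0 : ℝ) 1) (ht : t ∈ Ioo (0 : ℝ) (1 / 3)) :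
    |ratioCubeDeriv c t| ≤ 128 := by
  have h := two_thirds_le_one_sub_mul hc ht
  have h4 : (2 / 3 : ℝ) ^ 4 ≤ (1 - c * t) ^ 4 := pow_le_pow_left₀ (by norm_num) h 4
  have hpos : 0 < (1 - c * t) ^ 4 := by positivity
  have hn : (1 - c) * (1 - t) ^ 2 ≤ 1 := by
    have : (1 - t) ^ 2 ≤ 1 := by nlinarith [ht.1, ht.2]
    nlinarith [hc.1, hc.2, sq_nonneg (1 - t)]
  have hn0 : 0 ≤ (1 - c) * (1 - t) ^ 2 := mul_nonneg (by linarith [hc.2]) (sq_nonneg _)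
  rw [ratioCubeDeriv, abs_div, abs_neg, abs_of_pos hpos, abs_of_nonneg (by linarith),
    div_le_iff₀ hpos]
  linarith

theorem abs_ratioCubeDeriv₂_le {c t : ℝ} (hc : c ∈ Icc (0 : ℝ) 1)
    (ht : t ∈ Ioo (0 : ℝ) (1 / 3)) : |ratioCubeDeriv₂ c t| ≤ 128 := by
  have h := two_thirds_le_one_sub_mul hc ht
  have h4 : (2 / 3 : ℝ) ^ 4 ≤ (1 - c * t) ^ 4 := pow_le_pow_left₀ (by norm_num) h 4
  have h5 : (2 / 3 : ℝ) ^ 5 ≤ (1 - c * t) ^ 5 := pow_le_pow_left₀ (by norm_num) h 5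
  have hpos4 : 0 < (1 - c * t) ^ 4 := by positivity
  have hpos5 : 0 < (1 - c * t) ^ 5 := by positivity
  have hc1 : 0 ≤ 1 - c := by linarith [hc.2]
  have ht1 : 0 ≤ 1 - t := by linarith [ht.2]
  have ht2 : (1 - t) ^ 2 ≤ 1 := by nlinarith [ht.1, ht.2]
  have n1 : (1 - c) * (1 - t) ≤ 1 := by nlinarith [hc.1, ht.1]
  have n2 : c * (1 - c) * (1 - t) ^ 2 ≤ 1 := by
    have : c * (1 - c) ≤ 1 := by nlinarith [hc.1]
    nlinarith [sq_nonneg (1 - t), mul_nonneg hc.1 hc1]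
  have p1 : 0 ≤ 6 * (1 - c) * (1 - t) / (1 - c * t) ^ 4 := by positivity
  have p2 : 0 ≤ 12 * c * (1 - c) * (1 - t) ^ 2 / (1 - c * t) ^ 5 := by
    have := hc.1
    positivity
  have q1 : 6 * (1 - c) * (1 - t) / (1 - c * t) ^ 4 ≤ 128 := by
    rw [div_le_iff₀ hpos4]; linarith
  have q2 : 12 * c * (1 - c) * (1 - t) ^ 2 / (1 - c * t) ^ 5 ≤ 128 := by
    rw [div_le_iff₀ hpos5]; linarith
  rw [ratioCubeDeriv₂, abs_le]
  constructor <;> linarith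

theorem ratioCubeDeriv_neg {c t : ℝ} (hc : c ∈ Ico (0 : ℝ) 1) (ht : t ∈ Ioo (0 : ℝ) (1 / 3)) :
    ratioCubeDeriv c t < 0 := by
  have h := two_thirds_le_one_sub_mul ⟨hc.1, hc.2.le⟩ ht
  have h1 : 0 < 1 - c := by linarith [hc.2]
  have h2 : 0 < 1 - t := by linarith [ht.2]
  exact div_neg_of_neg_of_pos (neg_neg_of_pos (by positivity)) (by positivity)

/-- This is where `t < 1/3` matters: the sign is governed by `(1 - 3t)(1 - ct) + 4ct(1 - t)`, which
at `c = 0` is just `1 - 3t`. -/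
theorem ratioCubeDeriv_add_neg {c t : ℝ} (hc : c ∈ Ico (0 : ℝ) 1) (ht : t ∈ Ioo (0 : ℝ) (1 / 3)) :
    ratioCubeDeriv c t + t * ratioCubeDeriv₂ c t < 0 := by
  have h := two_thirds_le_one_sub_mul ⟨hc.1, hc.2.le⟩ ht
  have h0 : 0 < 1 - c * t := by linarith
  have h1 : 0 < 1 - c := by linarith [hc.2]
  have h2 : 0 < 1 - t := by linarith [ht.2]
  have h3 : 0 < 1 - 3 * t := by linarith [ht.2]
  have hc0 := hc.1
  have ht0 := ht.1
  have e : ratioCubeDeriv c t + t * ratioCubeDeriv₂ c t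
      = -(3 * (1 - c) * (1 - t) * ((1 - 3 * t) * (1 - c * t) + 4 * c * t * (1 - t)))
        / (1 - c * t) ^ 5 := by
    rw [ratioCubeDeriv, ratioCubeDeriv₂]
    field_simp
    ring
  rw [e]
  exact div_neg_of_neg_of_pos (neg_neg_of_pos (by positivity)) (by positivity)

/-- For `m = ratioCube`, the diagonal of the Bergman kernel of the shell divided by that of the
ball is `1 + excess m q`. -/
def excess (m : ℝ → ℝ → ℝ) (q t : ℝ) : ℝ := ∑' j : ℕ, (q ^ 2) ^ (j + 1) * m (q ^ (j + 1)) t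

theorem summable_excess_bound {q : ℝ} (hq : q ∈ Ico (0 : ℝ) 1) (C : ℝ) :
    Summable fun j : ℕ => (q ^ 2) ^ (j + 1) * C :=
  ((summable_geometric_of_lt_one (by positivity) (by nlinarith [hq.1, hq.2])).comp_injective
    (add_left_injective 1)).mul_right C

theorem pow_succ_mem_Ico {q : ℝ} (hq : q ∈ Ico (0 : ℝ) 1) (j : ℕ) : q ^ (j + 1) ∈ Ico (0 : ℝ) 1 :=
  ⟨pow_nonneg hq.1 _, pow_lt_one₀ hq.1 hq.2 (Nat.succ_ne_zero j)⟩

theorem summable_excess {m : ℝ → ℝ → ℝ} {q t C : ℝ} (hq : q ∈ Ico (0 : ℝ) 1)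
    (hm : ∀ c ∈ Icc (0 : ℝ) 1, |m c t| ≤ C) :
    Summable fun j : ℕ => (q ^ 2) ^ (j + 1) * m (q ^ (j + 1)) t :=
  Summable.of_norm_bounded (summable_excess_bound hq C) fun j => by
    rw [norm_mul, Real.norm_of_nonneg (by positivity)]
    exact mul_le_mul_of_nonneg_left (hm _ (Ico_subset_Icc_self (pow_succ_mem_Ico hq j)))
      (by positivity)

theorem hasDerivAt_excess {m m' : ℝ → ℝ → ℝ} {q C : ℝ} (hq : q ∈ Ico (0 : ℝ) 1)
    (hd : ∀ c ∈ Icc (0 : ℝ) 1, ∀ t ∈ Ioo (0 : ℝ) (1 / 3), HasDerivAt (m c) (m' c t) t)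
    (hm : ∀ c ∈ Icc (0 : ℝ) 1, ∀ t ∈ Ioo (0 : ℝ) (1 / 3), |m c t| ≤ C)
    (hm' : ∀ c ∈ Icc (0 : ℝ) 1, ∀ t ∈ Ioo (0 : ℝ) (1 / 3), |m' c t| ≤ C)
    {t : ℝ} (ht : t ∈ Ioo (0 : ℝ) (1 / 3)) :
    HasDerivAt (excess m q) (excess m' q t) t := by
  refine hasDerivAt_tsum_of_isPreconnected (summable_excess_bound hq C) isOpen_Ioo
    isPreconnected_Ioo (fun j y hy => (hd _ (Ico_subset_Icc_self (pow_succ_mem_Ico hq j)) y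
      hy).const_mul _) (fun j y hy => ?_) ht (summable_excess hq fun c hc => hm c hc t ht) ht
  rw [norm_mul, Real.norm_of_nonneg (by positivity)]
  exact mul_le_mul_of_nonneg_left (hm' _ (Ico_subset_Icc_self (pow_succ_mem_Ico hq j)) y hy)
    (by positivity)

theorem abs_ratioCube_le {c t : ℝ} (hc : c ∈ Icc (0 : ℝ) 1) (ht : t ∈ Ioo (0 : ℝ) (1 / 3)) :
    |ratioCube c t| ≤ 128 := by
  have h := two_thirds_le_one_sub_mul hc ht
  have ht1 : 0 ≤ 1 - t := by linarith [ht.2]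
  have hle : 1 - t ≤ 1 - c * t := by nlinarith [hc.2, ht.1]
  rw [ratioCube, abs_of_nonneg (by positivity), div_le_iff₀ (by positivity)]
  have := pow_le_pow_left₀ ht1 hle 3
  nlinarith [pow_nonneg ht1 3]

theorem excess_ratioCube_nonneg {q t : ℝ} (hq : q ∈ Ico (0 : ℝ) 1) (ht : t ∈ Ioo (0 : ℝ) (1 / 3)) :
    0 ≤ excess ratioCube q t :=
  tsum_nonneg fun j => by
    have h := two_thirds_le_one_sub_mul (Ico_subset_Icc_self (pow_succ_mem_Ico hq j)) ht
    have ht1 : 0 ≤ 1 - t := by linarith [ht.2]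
    have := hq.1
    rw [ratioCube]
    positivity

/-- Strictness needs `q > 0`, which makes the weight of the first term positive. -/
theorem excess_neg {m : ℝ → ℝ → ℝ} {q t C : ℝ} (hq : q ∈ Ioo (0 : ℝ) 1)
    (hm : ∀ c ∈ Icc (0 : ℝ) 1, |m c t| ≤ C) (hneg : ∀ c ∈ Ico (0 : ℝ) 1, m c t < 0) :
    excess m q t < 0 := by
  have hq' : q ∈ Ico (0 : ℝ) 1 := ⟨hq.1.le, hq.2⟩
  have hlt : ∀ j : ℕ, 0 < -((q ^ 2) ^ (j + 1) * m (q ^ (j + 1)) t) := fun j =>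
    neg_pos.2 (mul_neg_of_pos_of_neg (by have := hq.1; positivity)
      (hneg _ (pow_succ_mem_Ico hq' j)))
  have := (summable_excess hq' hm).neg.tsum_pos (fun j => (hlt j).le) 0 (hlt 0)
  rw [tsum_neg] at this
  exact neg_pos.1 this

theorem excess_zero (m : ℝ → ℝ → ℝ) (t : ℝ) : excess m 0 t = 0 := by
  simp [excess]

/-! ### The metric of a shell and the comparison with the ball. -/

/-- The logarithm of the Bergman kernel of a shell on the diagonal, as a function of `|z|²`. -/
def logProfile (q t : ℝ) : ℝ :=
  Real.log (2 / π ^ 2) - 3 * Real.log (1 - t) + Real.log (1 + excess ratioCube q t)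

/-- The first derivative of `logProfile q`. -/
def logProfileDeriv (q t : ℝ) : ℝ :=
  3 / (1 - t) + excess ratioCubeDeriv q t / (1 + excess ratioCube q t)

/-- The second derivative of `logProfile q`. -/
def logProfileDeriv₂ (q t : ℝ) : ℝ :=
  3 / (1 - t) ^ 2 + excess ratioCubeDeriv₂ q t / (1 + excess ratioCube q t)
    - (excess ratioCubeDeriv q t / (1 + excess ratioCube q t)) ^ 2

theorem hasDerivAt_excess_ratioCube {q t : ℝ} (hq : q ∈ Ico (0 : ℝ) 1)
    (ht : t ∈ Ioo (0 : ℝ) (1 / 3)) :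
    HasDerivAt (excess ratioCube q) (excess ratioCubeDeriv q t) t :=
  hasDerivAt_excess hq (fun _ hc _ ht => hasDerivAt_ratioCube
    (by linarith [two_thirds_le_one_sub_mul hc ht])) (fun _ hc _ ht => abs_ratioCube_le hc ht)
    (fun _ hc _ ht => abs_ratioCubeDeriv_le hc ht) ht

theorem hasDerivAt_excess_ratioCubeDeriv {q t : ℝ} (hq : q ∈ Ico (0 : ℝ) 1)
    (ht : t ∈ Ioo (0 : ℝ) (1 / 3)) :
    HasDerivAt (excess ratioCubeDeriv q) (excess ratioCubeDeriv₂ q t) t :=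
  hasDerivAt_excess hq (fun _ hc _ ht => hasDerivAt_ratioCubeDeriv
    (by linarith [two_thirds_le_one_sub_mul hc ht])) (fun _ hc _ ht => abs_ratioCubeDeriv_le hc ht)
    (fun _ hc _ ht => abs_ratioCubeDeriv₂_le hc ht) ht

theorem hasDerivAt_logProfile {q t : ℝ} (hq : q ∈ Ico (0 : ℝ) 1) (ht : t ∈ Ioo (0 : ℝ) (1 / 3)) :
    HasDerivAt (logProfile q) (logProfileDeriv q t) t := by
  have h1 : HasDerivAt (fun t : ℝ => 1 - t) (-1) t := by simpa using (hasDerivAt_id t).const_sub 1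
  have h2 : 1 - t ≠ 0 := by linarith [ht.2]
  have h3 : 1 + excess ratioCube q t ≠ 0 := by linarith [excess_ratioCube_nonneg hq ht]
  refine ((((h1.log h2).const_mul 3).const_sub (Real.log (2 / π ^ 2))).fun_add
    (((hasDerivAt_excess_ratioCube hq ht).const_add 1).log h3)).congr_deriv ?_
  rw [logProfileDeriv]
  ring

theorem hasDerivAt_logProfileDeriv {q t : ℝ} (hq : q ∈ Ico (0 : ℝ) 1)
    (ht : t ∈ Ioo (0 : ℝ) (1 / 3)) :
    HasDerivAt (logProfileDeriv q) (logProfileDeriv₂ q t) t := by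
  have h1 : HasDerivAt (fun t : ℝ => 1 - t) (-1) t := by simpa using (hasDerivAt_id t).const_sub 1
  have h2 : 1 - t ≠ 0 := by linarith [ht.2]
  have h3 : 1 + excess ratioCube q t ≠ 0 := by linarith [excess_ratioCube_nonneg hq ht]
  refine (((hasDerivAt_const t (3 : ℝ)).fun_div h1 h2).fun_add
    ((hasDerivAt_excess_ratioCubeDeriv hq ht).fun_div
      ((hasDerivAt_excess_ratioCube hq ht).const_add 1) h3)).congr_deriv ?_
  rw [logProfileDeriv₂]
  field_simp
  ring

/-- The term `j = 0` is split off and `(1 - t)^(-3)` factored out of the rest. -/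
theorem shellKernel_ofReal {q t : ℝ} (hq : q ∈ Ico (0 : ℝ) 1) (ht : t ∈ Ioo (0 : ℝ) (1 / 3)) :
    shellKernel q (t : ℂ)
      = ((2 / π ^ 2 * ((1 + excess ratioCube q t) / (1 - t) ^ 3) : ℝ) : ℂ) := by
  have ht1 : 1 - t ≠ 0 := by linarith [ht.2]
  have e1 : ∀ j, kernelTerm q j (t : ℂ) = ((q ^ (2 * j) / (1 - q ^ j * t) ^ 3 : ℝ) : ℂ) :=
    fun j => by rw [kernelTerm]; push_cast; rfl
  have hs : Summable fun j : ℕ => q ^ (2 * j) / (1 - q ^ j * t) ^ 3 := by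
    have := summable_kernelTerm hq.1 hq.2 (x := (t : ℂ)) (by
      rw [Complex.norm_real, Real.norm_of_nonneg ht.1.le]; linarith [ht.2])
    simp_rw [e1] at this
    exact Complex.summable_ofReal.1 this
  rw [shellKernel]
  simp_rw [e1]
  rw [← Complex.ofReal_tsum, ← Complex.ofReal_mul, hs.tsum_eq_zero_add, add_div]
  congr 3
  · simp
  · rw [excess, ← tsum_div_const]
    refine tsum_congr fun j => ?_
    have h := two_thirds_le_one_sub_mul (Ico_subset_Icc_self (pow_succ_mem_Ico hq j)) ht
    have h' : 1 - q ^ (j + 1) * t ≠ 0 := by linarith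
    rw [ratioCube, ← pow_mul]
    field_simp

theorem logBergmanKernel_euclideanShell {R : ℝ} (hR : R < 1) {z : EuclideanSpace ℂ (Fin 2)}
    (hz : z ∈ euclideanShell R) (ht : ‖z‖ ^ 2 ∈ Ioo (0 : ℝ) (1 / 3)) :
    logBergmanKernel (euclideanShell R) z = (logProfile (max R 0) (‖z‖ ^ 2) : ℝ) := by
  have hq : max R 0 ∈ Ico (0 : ℝ) 1 := ⟨le_max_right _ _, max_lt hR one_pos⟩
  have ht1 : 0 < 1 - ‖z‖ ^ 2 := by linarith [ht.2]
  have hS := excess_ratioCube_nonneg hq ht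
  have hin : (inner ℂ z z : ℂ) = ((‖z‖ ^ 2 : ℝ) : ℂ) := by
    rw [inner_self_eq_norm_sq_to_K]; push_cast; rfl
  rw [logBergmanKernel, (isBergmanKernel_euclideanShell hR).eq_bergmanKernel hz hz, hin,
    shellKernel_ofReal hq ht, Complex.ofReal_re, logProfile]
  have hpi := pi_pos
  have hS1 : 1 + excess ratioCube (max R 0) (‖z‖ ^ 2) ≠ 0 := by linarith
  rw [Real.log_mul (by positivity) (by positivity), Real.log_div hS1 (by positivity),
    Real.log_pow]
  push_cast
  ring

theorem bergmanMetric_euclideanShell {R s : ℝ} (hR : R < 1) (hRs : R < s ^ 2)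
    (hs : s ^ 2 ∈ Ioo (0 : ℝ) (1 / 3)) (ξ : EuclideanSpace ℂ (Fin 2)) :
    bergmanMetric (euclideanShell R) !₂[(s : ℂ), 0] ξ
      = √((logProfileDeriv (max R 0) (s ^ 2) + s ^ 2 * logProfileDeriv₂ (max R 0) (s ^ 2))
          * ‖ξ 0‖ ^ 2 + logProfileDeriv (max R 0) (s ^ 2) * ‖ξ 1‖ ^ 2) := by
  have hq : max R 0 ∈ Ico (0 : ℝ) 1 := ⟨le_max_right _ _, max_lt hR one_pos⟩
  refine bergmanMetric_eq_sqrt (L := logProfile (max R 0)) ?_ ?_ (hasDerivAt_logProfileDeriv hq hs) ξ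
  · have hpn : ‖(!₂[(s : ℂ), 0] : EuclideanSpace ℂ (Fin 2))‖ ^ 2 = s ^ 2 := by
      rw [EuclideanSpace.norm_sq_eq, Fin.sum_univ_two]
      simp
    have hc : ContinuousAt (fun z : EuclideanSpace ℂ (Fin 2) => ‖z‖ ^ 2) !₂[(s : ℂ), 0] := by
      fun_prop
    have hm : !₂[(s : ℂ), 0] ∈ euclideanShell R :=
      ⟨by rwa [hpn], by rw [hpn]; linarith [hs.2]⟩
    filter_upwards [(isOpen_euclideanShell R).mem_nhds hm,
      hc.eventually (isOpen_Ioo.mem_nhds (by simpa only [hpn] using hs))] with z hz1 hz2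
    exact logBergmanKernel_euclideanShell hR hz1 hz2
  · filter_upwards [isOpen_Ioo.mem_nhds hs] with t ht
    exact hasDerivAt_logProfile hq ht

theorem logProfileDeriv_lt {q t : ℝ} (hq : q ∈ Ioo (0 : ℝ) 1) (ht : t ∈ Ioo (0 : ℝ) (1 / 3)) :
    logProfileDeriv q t < 3 / (1 - t) := by
  have hS := excess_ratioCube_nonneg ⟨hq.1.le, hq.2⟩ ht
  have h := excess_neg hq (fun c hc => abs_ratioCubeDeriv_le hc ht)
    fun c hc => ratioCubeDeriv_neg hc ht
  have := div_neg_of_neg_of_pos h (show 0 < 1 + excess ratioCube q t by linarith)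
  rw [logProfileDeriv]
  linarith

/-- `E' + tE''` is negative term by term, and the square coming from the second derivative of the
logarithm enters with a minus sign. -/
theorem logProfileDeriv_add_lt {q t : ℝ} (hq : q ∈ Ioo (0 : ℝ) 1)
    (ht : t ∈ Ioo (0 : ℝ) (1 / 3)) :
    logProfileDeriv q t + t * logProfileDeriv₂ q t < 3 / (1 - t) + t * (3 / (1 - t) ^ 2) := by
  have hq' : q ∈ Ico (0 : ℝ) 1 := ⟨hq.1.le, hq.2⟩
  have hS := excess_ratioCube_nonneg hq' ht
  have ht0 := ht.1
  have hadd : excess ratioCubeDeriv q t + t * excess ratioCubeDeriv₂ q t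
      = excess (fun c t => ratioCubeDeriv c t + t * ratioCubeDeriv₂ c t) q t := by
    have s1 := summable_excess hq' fun c hc => abs_ratioCubeDeriv_le hc ht
    have s2 := summable_excess hq' fun c hc => abs_ratioCubeDeriv₂_le hc ht
    simp only [excess]
    rw [← tsum_mul_left, ← s1.tsum_add (s2.mul_left t)]
    exact tsum_congr fun j => by ring
  have h := excess_neg (m := fun c t => ratioCubeDeriv c t + t * ratioCubeDeriv₂ c t) (t := t)
    (C := 128 + t * 128) hq (fun c hc => (abs_add_le _ _).trans (add_le_add
      (abs_ratioCubeDeriv_le hc ht) (by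
        rw [abs_mul, abs_of_pos ht0]
        exact mul_le_mul_of_nonneg_left (abs_ratioCubeDeriv₂_le hc ht) ht0.le)))
    fun c hc => ratioCubeDeriv_add_neg hc ht
  rw [← hadd] at h
  have h2 := div_neg_of_neg_of_pos h (show 0 < 1 + excess ratioCube q t by linarith)
  rw [add_div, mul_div_assoc] at h2
  have h3 := mul_nonneg ht0.le
    (sq_nonneg (excess ratioCubeDeriv q t / (1 + excess ratioCube q t)))
  rw [logProfileDeriv, logProfileDeriv₂]
  linarith

theorem ringDomain_eq_euclideanShell {r : ℝ} (hr : 0 < r) :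
    ringDomain 2 r = euclideanShell (r ^ 2) := by
  ext z
  simp only [ringDomain, euclideanShell, mem_ofPred_eq]
  rw [pow_lt_pow_iff_left₀ hr.le (norm_nonneg z) two_ne_zero, sq_lt_one_iff₀ (norm_nonneg z)]

/-- Any negative parameter would do; `0` would lose the origin. -/
theorem ball_eq_euclideanShell :
    ball (0 : EuclideanSpace ℂ (Fin 2)) 1 = euclideanShell (-1) := by
  ext z
  simp only [euclideanShell, mem_ofPred_eq, mem_ball_zero_iff, sq_lt_one_iff₀ (norm_nonneg z)]
  exact ⟨fun h => ⟨by linarith [sq_nonneg ‖z‖], h⟩, fun h => h.2⟩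

theorem theorem3 :
    ∃ δ : ℝ, 0 < δ ∧ ∀ r ε : ℝ, 0 < r → r < δ → 0 < ε → ε < δ →
      ∀ ξ : EuclideanSpace ℂ (Fin 2), ξ ≠ 0 →
        bergmanMetric (ringDomain 2 r) !₂[((r + ε : ℝ) : ℂ), 0] ξ
          < bergmanMetric (Metric.ball (0 : EuclideanSpace ℂ (Fin 2)) 1)
              !₂[((r + ε : ℝ) : ℂ), 0] ξ := by
  -- With `r, ε < 1/4`, `(r + ε)² < 1/4 < 1/3`.
  refine ⟨1 / 4, by norm_num, fun r ε hr hr4 hε hε4 ξ hξ => ?_⟩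
  have hs : (r + ε) ^ 2 ∈ Ioo (0 : ℝ) (1 / 3) := ⟨by positivity, by nlinarith⟩
  have hr1 : r ^ 2 < 1 := by nlinarith
  rw [ringDomain_eq_euclideanShell hr, ball_eq_euclideanShell,
    bergmanMetric_euclideanShell hr1 (by nlinarith) hs,
    bergmanMetric_euclideanShell (by norm_num) (by nlinarith [hs.1]) hs,
    max_eq_left (sq_nonneg r), max_eq_right (by norm_num)]
  have hq : r ^ 2 ∈ Ioo (0 : ℝ) 1 := ⟨by positivity, hr1⟩
  have h1 := logProfileDeriv_lt hq hs
  have h2 := logProfileDeriv_add_lt hq hs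
  set t := (r + ε) ^ 2
  have e1 : logProfileDeriv 0 t = 3 / (1 - t) := by simp [logProfileDeriv, excess_zero]
  have e2 : logProfileDeriv₂ 0 t = 3 / (1 - t) ^ 2 := by simp [logProfileDeriv₂, excess_zero]
  rw [e1, e2]
  have ht1 : 0 < 1 - t := by linarith [hs.2]
  have ht0 := hs.1
  have b1 : 0 < 3 / (1 - t) := by positivity
  have b2 : 0 < 3 / (1 - t) + t * (3 / (1 - t) ^ 2) := by positivity
  have hξ' : 0 < ‖ξ 0‖ ^ 2 ∨ 0 < ‖ξ 1‖ ^ 2 := by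
    by_contra! h
    apply hξ
    have h0 : ξ 0 = 0 := by
      simpa using le_antisymm h.1 (sq_nonneg _)
    have h1 : ξ 1 = 0 := by
      simpa using le_antisymm h.2 (sq_nonneg _)
    ext i
    fin_cases i
    · exact h0
    · exact h1
  have n0 := sq_nonneg ‖ξ 0‖
  have n1 := sq_nonneg ‖ξ 1‖
  have hpos : 0 < (3 / (1 - t) + t * (3 / (1 - t) ^ 2)) * ‖ξ 0‖ ^ 2
      + 3 / (1 - t) * ‖ξ 1‖ ^ 2 := by
    rcases hξ' with h | h
    · exact add_pos_of_pos_of_nonneg (mul_pos b2 h) (mul_nonneg b1.le n1)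
    · exact add_pos_of_nonneg_of_pos (mul_nonneg b2.le n0) (mul_pos b1 h)
  rw [Real.sqrt_lt_sqrt_iff_of_pos hpos]
  rcases hξ' with h | h
  · exact add_lt_add_of_lt_of_le (mul_lt_mul_of_pos_right h2 h) (mul_le_mul_of_nonneg_right h1.le n1)
  · exact add_lt_add_of_le_of_lt (mul_le_mul_of_nonneg_right h2.le n0) (mul_lt_mul_of_pos_right h1 h)

end
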